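/- **Theorem (Generalized adjoint method on manifolds).** Let $\mathcal M$ and $\mathcal P$ be finite-dimensional smooth manifolds without boundary, with $\mathcal M$ Hausdorff. Let $f_\theta(x,t)\in T_x\mathcal M$ be a (possibly time-dependent) vector field on $\mathcal M$ parameterized by $\theta\in\mathcal P$, of class $C^1$ jointly in $(\theta,t,x)\in\mathcal P\times\mathbb R\times\mathcal M$. Let $F:\mathcal M\times\mathcal P\to\mathbb R$ be differentiable and let $r:\mathcal M\times\mathcal P\times\mathbb R\to\mathbb R$ be of class $C^1$. Let $T\ge 0$ and $x_0\in\mathcal M$, and suppose that for every $\theta\in\mathcal P$ the initial value problem $\dot x=f_\theta(x,t)$, $x(0)=x_0$, has a solution on $[0,T]$; write $\Psi^t_{f_\theta}(x_0)$ for its value at time $t$ (the flow). Define the cost $$C^T_{f_\theta}(x_0,\theta)=F\big(\Psi^T_{f_\theta}(x_0),\theta\big)+\int_0^T r\big(\Psi^s_{f_\theta}(x_0),\theta,s\big)\,\mathrm ds .$$ Then the integrand $s\mapsto r(\Psi^s_{f_\theta}(x_0),\theta,s)$ is integrable on $[0,T]$ for every $\theta$, and for every $\theta\in\mathcal P$ the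 function $\theta'\mapsto C^T_{f_{\theta'}}(x_0,\theta')$ is differentiable at $\theta$. Moreover, put $x(t)=\Psi^t_{f_\theta}(x_0)$. There is a family of covectors $\lambda(t)\in T^*_{x(t)}\mathcal M$ (the adjoint state), unique for $t\in[0,T]$, such that in every chart of the smooth manifold $\mathcal M$, with the induced coordinates, at all times $t\in[0,T]$ at which $x(t)$ lies in the chart domain (with one-sided derivatives at $t=0$ and $t=T$; summation over $j$), $$\dot x^j=f^j_\theta(x,t),\quad x(0)=x_0,\qquad\qquad \dot\lambda_i=-\lambda_j\,\frac{\partial f_\theta^j}{\partial x^i}(x,t)-\frac{\partial r}{\partial x^i}(x,\theta,t),\quad \lambda(T)=\mathrm d_xF\big(x(T),\theta\big).$$ Finally, for every $t\in[0,T]$ the function $\theta'\mapsto\lambda(t)\big(f_{\theta'}(x(t),t)\big)+r(x(t),\theta',t)$ is differentiable at $\theta$, its differential at $\theta$ is an integrable function of $t\in[0,T]$, and the parameter gradient in $T^*_\theta\mathcal P$ is $$\mathrm d_\theta C^T_{f_\theta}(x_0,\theta)=\mathrm d_\theta F\big(x(T),\theta\big)+\int_0^T \mathrm d_\theta\Big(\lambda(t)\big(f_\theta(x(t),t)\big)+r\big(x(t),\theta,t\big)\Big)\,\mathrm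 dt ,$$ where the differentials $\mathrm d_\theta$ on the right-hand side are partial differentials in the parameter, taken with $x(t)$ and $\lambda(t)$ held fixed. -/

import Mathlib

open scoped Manifold ContDiff

noncomputable section

namespace AdjointMethod

variable {n : ℕ} {M : Type*} [TopologicalSpace M] [ChartedSpace (EuclideanSpace ℝ (Fin n)) M]
  {P : Type*}

/-- `x` is a solution on the time set `s` of `x' = f_θ(x, t)`, `x(0) = x₀`. The derivative at the
end points of an interval is the one-sided one. -/
def IsSolutionOn (f : P → ℝ → (x : M) → TangentSpace (𝓡 n) x) (θ : P) (x₀ : M) (s : Set ℝ)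
    (x : ℝ → M) : Prop :=
  x 0 = x₀ ∧ ∀ t ∈ s, HasMFDerivWithinAt 𝓘(ℝ, ℝ) (𝓡 n) x s t
    (ContinuousLinearMap.toSpanSingleton ℝ (f θ t (x t)))

open Classical in
/-- The flow `Ψ_{f_θ}^t(x₀)`: the value at time `t` of the solution of `x' = f_θ(x, t)` that starts
at `x₀` at time `0`, whenever a solution exists between the times `0` and `t`
(on a Hausdorff manifold and for `f` of class `C^1` the value does not depend on the solution;
if no solution reaches time `t` the value is the irrelevant `x₀`). -/
def flow (f : P → ℝ → (x : M) → TangentSpace (𝓡 n) x) (θ : P) (t : ℝ) (x₀ : M) : M :=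
  if h : ∃ x : ℝ → M, IsSolutionOn f θ x₀ (Set.uIcc 0 t) x then h.choose t else x₀

/-- The cost `C(x₀, θ) = F(Ψ^T(x₀), θ) + ∫₀ᵀ r(Ψ^s(x₀), θ, s) ds`. -/
def cost (f : P → ℝ → (x : M) → TangentSpace (𝓡 n) x) (F : M → P → ℝ) (r : M → P → ℝ → ℝ)
    (T : ℝ) (x₀ : M) (θ : P) : ℝ :=
  F (flow f θ T x₀) θ + ∫ s in (0 : ℝ)..T, r (flow f θ s x₀) θ s

/-! ### Coordinate expressions in a chart `e` of `M` -/

/-- The coordinate vector `∂/∂xⁱ` at `x`: the tangent vector that the differential of the chart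
sends to the `i`-th standard basis vector. -/
def coordVec (e : OpenPartialHomeomorph M (EuclideanSpace ℝ (Fin n))) (x : M) (i : Fin n) :
    TangentSpace (𝓡 n) x :=
  (mfderiv (𝓡 n) (𝓡 n) e x).inverse (EuclideanSpace.single i (1 : ℝ))

/-- The component `λ_i = λ(∂/∂xⁱ)` of a covector at `x`. -/
def covecComp (e : OpenPartialHomeomorph M (EuclideanSpace ℝ (Fin n))) (x : M)
    (l : TangentSpace (𝓡 n) x →L[ℝ] ℝ) (i : Fin n) : ℝ :=
  l (coordVec e x i)

/-- The component `v^j = dx^j(v)` of a tangent vector at `x`. -/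
def vecComp (e : OpenPartialHomeomorph M (EuclideanSpace ℝ (Fin n))) (x : M)
    (v : TangentSpace (𝓡 n) x) (j : Fin n) : ℝ :=
  (show EuclideanSpace ℝ (Fin n) from mfderiv (𝓡 n) (𝓡 n) e x v) j

/-- The partial derivative `∂h/∂xⁱ` at `x` of a function `h` on `M`. -/
def partialDeriv (e : OpenPartialHomeomorph M (EuclideanSpace ℝ (Fin n))) (i : Fin n)
    (h : M → ℝ) (x : M) : ℝ :=
  fderiv ℝ (fun u : EuclideanSpace ℝ (Fin n) => h (e.symm u)) (e x) (EuclideanSpace.single i 1)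

/-- The differential `dg(q) ∈ T*_q N` of a real function `g` on a manifold `N`. -/
def differential {m : ℕ} {N : Type*} [TopologicalSpace N]
    [ChartedSpace (EuclideanSpace ℝ (Fin m)) N] (g : N → ℝ) (q : N) :
    TangentSpace (𝓡 m) q →L[ℝ] ℝ :=
  mfderiv (𝓡 m) 𝓘(ℝ, ℝ) g q

variable [IsManifold (𝓡 n) ∞ M]

/-- The state equation `x'^j = f^j(x)` on `[0, T]` in every chart of the smooth manifold `M`. -/
def StateEqInCharts (f : P → ℝ → (x : M) → TangentSpace (𝓡 n) x) (θ : P) (T : ℝ)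
    (x : ℝ → M) : Prop :=
  ∀ e ∈ IsManifold.maximalAtlas (𝓡 n) ∞ M, ∀ t ∈ Set.Icc 0 T, x t ∈ e.source → ∀ j : Fin n,
    HasDerivWithinAt (fun s => e (x s) j) (vecComp e (x t) (f θ t (x t)) j) (Set.Icc 0 T) t

/-- `l` is an adjoint state along the curve `x`: a field of covectors `l(t) ∈ T*_{x(t)}M` with
`l_i' = - l_j ∂f^j/∂xⁱ - ∂r/∂xⁱ` on `[0, T]` in every chart of the smooth manifold `M`, and with
the final value `l(T) = d_x F(x(T), θ)`. -/
def IsAdjointState (f : P → ℝ → (x : M) → TangentSpace (𝓡 n) x) (F : M → P → ℝ)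
    (r : M → P → ℝ → ℝ) (θ : P) (T : ℝ) (x : ℝ → M)
    (l : (t : ℝ) → TangentSpace (𝓡 n) (x t) →L[ℝ] ℝ) : Prop :=
  (∀ e ∈ IsManifold.maximalAtlas (𝓡 n) ∞ M, ∀ t ∈ Set.Icc 0 T, x t ∈ e.source → ∀ i : Fin n,
    HasDerivWithinAt (fun s => covecComp e (x s) (l s) i)
      (-(∑ j, covecComp e (x t) (l t) j *
          partialDeriv e i (fun y => vecComp e y (f θ t y) j) (x t))
        - partialDeriv e i (fun y => r y θ t) (x t))
      (Set.Icc 0 T) t) ∧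
  l T = differential (fun y => F y θ) (x T)

end AdjointMethod

end

/-! Write H(θ, x, λ, t) = λ(f_θ(x, t)) + r(x, θ, t). If η is the variation of the state under a
change of θ, then η' = ∂_x f · η + ∂_θ f. The adjoint equation is chosen so that the η terms cancel
in the derivative of λ(η) + ∫ δr, where δr is the variation of the running cost; only ∂_θ H remains.
Since η(0) = 0 and λ(T) = d_x F, integrating over [0, T] turns the implicit dependence of the cost
on θ into ∫ ∂_θ H.

Differentiability of the flow in θ is never needed. Grönwall's inequality bounds the actual
displacement of nearby solutions by a multiple of the parameter change (`exists_tube`), and a Taylor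
expansion uniform along the compact trajectory gives the pairing identity up to o(w - w₀)
(`adjoint_pairing_isLittleO`).

A trajectory need not stay in one chart, so everything is proved on short intervals and concatenated
by `interval_induction`. Two facts make the pieces fit. The adjoint equation has the same form in
all charts, by symmetry of the second derivative of the transition map
(`adjoint_equation_transition`). The pairing of a covector with a displacement changes only by o(w -
w₀) from chart to chart (`displacement_transition`). The chain rule for F at the final time then
gives the gradient (`hasMFDerivAt_cost`). -/

section

open scoped Topology NNReal
open Set Filter MeasureTheory Asymptotics

noncomputable section

namespace AdjointMethod

/-! ### Concatenation along intervals, Grönwall estimates and linear ODEs. -/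

section Analysis

/-- A relation between the end points of subintervals of `[a, b]` that is transitive and holds
locally holds for `[a, b]`. -/
theorem interval_induction {R : ℝ → ℝ → Prop} {a b : ℝ} (hab : a ≤ b)
    (htrans : ∀ s t u, a ≤ s → s ≤ t → t ≤ u → u ≤ b → R s t → R t u → R s u)
    (hloc : ∀ t ∈ Icc a b, ∃ ε > 0, ∀ s u, a ≤ s → s ≤ u → u ≤ b → t - ε < s → u < t + ε → R s u) :
    R a b := by
  set S : Set ℝ := {t | t ∈ Icc a b ∧ R a t} with hS
  -- Locality includes degenerate intervals, so it also supplies reflexivity at `a`.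
  have haS : a ∈ S := by
    obtain ⟨ε, hε, h⟩ := hloc a ⟨le_rfl, hab⟩
    exact ⟨⟨le_rfl, hab⟩, h a a le_rfl le_rfl hab (by linarith) (by linarith)⟩
  have hbdd : BddAbove S := ⟨b, fun t ht => ht.1.2⟩
  set c := sSup S with hc
  have hac : a ≤ c := le_csSup hbdd haS
  have hcb : c ≤ b := csSup_le ⟨a, haS⟩ fun t ht => ht.1.2
  obtain ⟨ε, hε, h⟩ := hloc c ⟨hac, hcb⟩
  obtain ⟨s, hsS, hs⟩ := exists_lt_of_lt_csSup ⟨a, haS⟩ (show c - ε < sSup S by linarith)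
  have hsc : s ≤ c := le_csSup hbdd hsS
  have hRc : R a c := htrans a s c le_rfl hsS.1.1 hsc hcb hsS.2
    (h s c hsS.1.1 hsc hcb hs (by linarith))
  rcases hcb.eq_or_lt with hcb' | hcb'
  · rwa [hcb'] at hRc
  · exfalso
    set u := min b (c + ε / 2)
    have hcu : c < u := lt_min hcb' (by linarith)
    have hub : u ≤ b := min_le_left _ _
    have : u ∈ S := ⟨⟨hac.trans hcu.le, hub⟩, htrans a c u le_rfl hac hcu.le hub hRc
      (h c u hac hcu.le hub (by linarith) ((min_le_right _ _).trans_lt (by linarith)))⟩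
    exact absurd (le_csSup hbdd this) (not_le.2 hcu)

/-- A curve that cannot reach the boundary of an open set as long as it stays in the set never
leaves it. -/
theorem mem_of_forall_mem_closed {M : Type*} [TopologicalSpace M] {y : ℝ → M} {a b : ℝ}
    {B C : Set M} (hy : ContinuousOn y (Icc a b)) (hB : IsOpen B) (hC : IsClosed C) (hCB : C ⊆ B)
    (ha : y a ∈ B) (h : ∀ t ∈ Icc a b, (∀ s ∈ Icc a t, y s ∈ B) → y t ∈ C) :
    ∀ t ∈ Icc a b, y t ∈ B := by
  by_contra! hne
  have hZ : IsCompact (Icc a b ∩ y ⁻¹' Bᶜ) :=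
    isCompact_Icc.of_isClosed_subset (hy.preimage_isClosed_of_isClosed isClosed_Icc hB.isClosed_compl)
      inter_subset_left
  -- At the first time `τ` outside `B` the curve has been in `C` on all of `[a, τ)`; as `C` is
  -- closed, `y τ ∈ C ⊆ B`, a contradiction.
  obtain ⟨τ, ⟨hτ, hτB⟩, hmin⟩ := hZ.exists_isLeast (by
    obtain ⟨t, ht, htB⟩ := hne
    exact ⟨t, ht, htB⟩)
  have hlt : a < τ := lt_of_le_of_ne hτ.1 (by rintro rfl; exact hτB ha)
  have hsub : Ico a τ ⊆ Icc a b := fun s hs => ⟨hs.1, hs.2.le.trans hτ.2⟩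
  have hIn : ∀ s ∈ Ico a τ, y s ∈ B := fun s hs => by
    by_contra hsB
    exact absurd (hmin ⟨hsub hs, hsB⟩) (not_le.2 hs.2)
  have hInC : ∀ s ∈ Ico a τ, y s ∈ C := fun s hs =>
    h s (hsub hs) fun u hu => hIn u ⟨hu.1, hu.2.trans_lt hs.2⟩
  have hcl : τ ∈ closure (Ico a τ) := by
    rw [closure_Ico hlt.ne]
    exact ⟨hlt.le, le_rfl⟩
  have : y τ ∈ closure C :=
    ((hy τ hτ).mono hsub).mem_closure hcl hInC
  exact hτB (hCB (hC.closure_eq ▸ this))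

variable {E V Z : Type*} [NormedAddCommGroup E] [NormedSpace ℝ E] [NormedAddCommGroup V]
  [NormedSpace ℝ V] [NormedAddCommGroup Z] [NormedSpace ℝ Z]

/-- A function of class `C¹` is uniformly differentiable along a compact set. -/
theorem _root_.ContDiffOn.uniform_fderiv_of_isCompact {g : Z → V} {U K : Set Z}
    (hg : ContDiffOn ℝ 1 g U)
    (hU : IsOpen U) (hK : IsCompact K) (hKU : K ⊆ U) {ε : ℝ} (hε : 0 < ε) :
    ∃ δ > 0, ∀ k ∈ K, ∀ z, ‖z - k‖ < δ →
      ‖g z - g k - fderiv ℝ g k (z - k)‖ ≤ ε * ‖z - k‖ := by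
  refine hK.induction_on (p := fun s => ∃ δ > 0, ∀ k ∈ s, ∀ z, ‖z - k‖ < δ →
      ‖g z - g k - fderiv ℝ g k (z - k)‖ ≤ ε * ‖z - k‖) ⟨1, one_pos, by simp⟩ ?_ ?_ ?_
  · rintro s t hst ⟨δ, hδ, h⟩
    exact ⟨δ, hδ, fun k hk => h k (hst hk)⟩
  · rintro s t ⟨δ, hδ, h⟩ ⟨δ', hδ', h'⟩
    refine ⟨min δ δ', lt_min hδ hδ', ?_⟩
    rintro k (hk | hk) z hz
    · exact h k hk z (hz.trans_le (min_le_left _ _))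
    · exact h' k hk z (hz.trans_le (min_le_right _ _))
  · intro k₀ hk₀
    have hU₀ : U ∈ 𝓝 k₀ := hU.mem_nhds (hKU hk₀)
    -- Strict differentiability moves both points near `k₀` but keeps the derivative at `k₀`;
    -- continuity of the derivative replaces it by the one at `k`. Each costs ε / 2.
    have hs := (hg.contDiffAt hU₀).hasStrictFDerivAt one_ne_zero
    have h1 := hs.isLittleO.def (half_pos hε)
    have hcont : ContinuousAt (fderiv ℝ g) k₀ :=
      (hg.continuousOn_fderiv_of_isOpen hU le_rfl).continuousAt hU₀
    have h2 : ∀ᶠ k in 𝓝 k₀, ‖fderiv ℝ g k - fderiv ℝ g k₀‖ < ε / 2 := by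
      have := hcont.eventually (Metric.ball_mem_nhds _ (half_pos hε))
      filter_upwards [this] with k hk
      simpa [dist_eq_norm] using hk
    obtain ⟨η, hη, h3⟩ := Metric.eventually_nhds_iff.1 h1
    obtain ⟨η', hη', h4⟩ := Metric.eventually_nhds_iff.1 h2
    refine ⟨Metric.ball k₀ (min (η / 2) η'), mem_nhdsWithin_of_mem_nhds
      (Metric.ball_mem_nhds _ (lt_min (half_pos hη) hη')), η / 2, half_pos hη, ?_⟩
    intro k hk z hz
    have hk1 : dist k k₀ < η / 2 := (Metric.mem_ball.1 hk).trans_le (min_le_left _ _)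
    have hz1 : dist z k₀ < η := by
      have := dist_triangle z k k₀
      rw [dist_eq_norm z k] at this
      linarith
    have e1 := h3 (y := (z, k)) (by
      rw [Prod.dist_eq]
      exact max_lt hz1 (by simpa using hk1.trans (half_lt_self hη)))
    have e2 := h4 ((Metric.mem_ball.1 hk).trans_le (min_le_right _ _))
    have e3 : ‖(fderiv ℝ g k - fderiv ℝ g k₀) (z - k)‖ ≤ ε / 2 * ‖z - k‖ :=
      (ContinuousLinearMap.le_opNorm _ _).trans (by gcongr)
    have e4 : g z - g k - fderiv ℝ g k (z - k) = (g z - g k - fderiv ℝ g k₀ (z - k))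
        - (fderiv ℝ g k - fderiv ℝ g k₀) (z - k) := by
      simp
    rw [e4]
    refine (norm_sub_le _ _).trans ?_
    simp only at e1
    linarith

/-- A parameter change enters as a defect proportional to the Lipschitz constant itself, so the
division by `K` in the Grönwall bound cancels and `K = 0` is no exception. -/
theorem gronwallBound_mul_le {K : ℝ≥0} {δ ε x : ℝ} (hε : 0 ≤ ε) :
    gronwallBound δ K (K * ε) x ≤ (δ + ε) * Real.exp (K * x) := by
  rcases eq_or_ne (K : ℝ) 0 with h | h
  · simp [h, gronwallBound_K0, hε]
  · rw [gronwallBound_of_K_ne_0 h, mul_div_cancel_left₀ _ h]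
    nlinarith

theorem _root_.HasDerivWithinAt.Icc_to_Ici {g : ℝ → V} {g' : V} {a b t : ℝ} (ht : t ∈ Ico a b)
    (h : HasDerivWithinAt g g' (Icc a b) t) : HasDerivWithinAt g g' (Ici t) t :=
  h.mono_of_mem_nhdsWithin (mem_of_superset (Icc_mem_nhdsGE ht.2) (Icc_subset_Icc_left ht.1))

theorem _root_.HasDerivWithinAt.Icc_to_Iic {g : ℝ → V} {g' : V} {a b t : ℝ} (ht : t ∈ Ioc a b)
    (h : HasDerivWithinAt g g' (Icc a b) t) : HasDerivWithinAt g g' (Iic t) t :=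
  h.mono_of_mem_nhdsWithin (mem_of_superset (Icc_mem_nhdsLE ht.1) (Icc_subset_Icc_right ht.2))

/-- Grönwall's estimate for two solutions of an ODE with different parameters. -/
theorem norm_sub_le_of_param_ode {W : Type*} [NormedAddCommGroup W] {G : W × ℝ × E → E} {K : ℝ≥0} {S : Set (W × ℝ × E)}
    (hG : LipschitzOnWith K G S) {X Y : ℝ → E} {w₀ w : W} {a b : ℝ}
    (hX : ∀ t ∈ Icc a b, HasDerivWithinAt X (G (w₀, t, X t)) (Icc a b) t)
    (hY : ∀ t ∈ Icc a b, HasDerivWithinAt Y (G (w, t, Y t)) (Icc a b) t)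
    (hXS : ∀ t ∈ Icc a b, (w₀, t, X t) ∈ S) (hYS : ∀ t ∈ Icc a b, (w, t, Y t) ∈ S)
    (hYS' : ∀ t ∈ Icc a b, (w₀, t, Y t) ∈ S) :
    ∀ t ∈ Icc a b, ‖Y t - X t‖ ≤ (‖Y a - X a‖ + ‖w - w₀‖) * Real.exp (K * (t - a)) := by
  intro t ht
  -- `Y` is treated as an approximate solution of the equation with parameter `w₀`; by the joint
  -- Lipschitz bound its defect is at most `K * ‖w - w₀‖`.
  have key := dist_le_of_approx_trajectories_ODE_of_mem (f := Y) (g := X) (a := a) (b := b)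
    (v := fun t u => G (w₀, t, u)) (K := K) (s := fun t => {u | (w₀, t, u) ∈ S})
    (f' := fun t => G (w, t, Y t)) (g' := fun t => G (w₀, t, X t)) (εf := K * ‖w - w₀‖) (εg := 0)
    (δ := ‖Y a - X a‖)
    (fun t _ => LipschitzOnWith.of_dist_le_mul fun u hu u' hu' => by
      simpa [Prod.dist_eq] using hG.dist_le_mul _ hu _ hu')
    (fun t ht => (hY t ht).continuousWithinAt)
    (fun t ht => (hY t (Ico_subset_Icc_self ht)).Icc_to_Ici ht)
    (fun t ht => by
      have := hG.dist_le_mul _ (hYS t (Ico_subset_Icc_self ht)) _ (hYS' t (Ico_subset_Icc_self ht))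
      simpa [Prod.dist_eq, dist_eq_norm] using this)
    (fun t ht => hYS' t (Ico_subset_Icc_self ht))
    (fun t ht => (hX t ht).continuousWithinAt)
    (fun t ht => (hX t (Ico_subset_Icc_self ht)).Icc_to_Ici ht)
    (fun t ht => by simp) (fun t ht => hXS t (Ico_subset_Icc_self ht)) (dist_eq_norm _ _).le t ht
  rw [dist_eq_norm, add_zero] at key
  exact key.trans (gronwallBound_mul_le (norm_nonneg _))

/-- Existence for linear ODEs with a final condition on a short interval. -/
theorem exists_linear_ode_solution [CompleteSpace V] {A : ℝ → V →L[ℝ] V} {β : ℝ → V} {a b C D : ℝ}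
    (hab : a ≤ b) (hA : ContinuousOn A (Icc a b)) (hβ : ContinuousOn β (Icc a b))
    (hAC : ∀ t ∈ Icc a b, ‖A t‖ ≤ C) (hβD : ∀ t ∈ Icc a b, ‖β t‖ ≤ D)
    (hshort : (2 * C + D) * (b - a) ≤ 1) (v : V) :
    ∃ Λ : ℝ → V, Λ b = v ∧ ∀ t ∈ Icc a b, HasDerivWithinAt Λ (A t (Λ t) + β t) (Icc a b) t := by
  have hC : 0 ≤ C := (norm_nonneg _).trans (hAC a ⟨le_rfl, hab⟩)
  have hD : 0 ≤ D := (norm_nonneg _).trans (hβD a ⟨le_rfl, hab⟩)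
  have hv := norm_nonneg v
  -- On the ball of radius `‖v‖ + 1` about `v` the field is bounded by `(2 * C + D) * (‖v‖ + 1)`.
  -- The radius cancels, so the admissible length does not depend on the final value `v`.
  have hPL : IsPicardLindelof (fun t u => A t u + β t) (⟨b, hab, le_rfl⟩ : Icc a b) v
      (⟨‖v‖ + 1, by positivity⟩ : ℝ≥0) 0 (⟨(2 * C + D) * (‖v‖ + 1), by positivity⟩ : ℝ≥0)
      (⟨C, hC⟩ : ℝ≥0) :=
    { lipschitzOnWith := fun t ht => LipschitzOnWith.of_dist_le_mul fun u _ u' _ => by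
        rw [dist_add_right, dist_eq_norm, dist_eq_norm, ← map_sub]
        exact (A t).le_of_opNorm_le (hAC t ht) _
      continuousOn := fun u _ => (hA.clm_apply continuousOn_const).add hβ
      norm_le := fun t ht u hu => by
        have hu' : ‖u‖ ≤ 2 * ‖v‖ + 1 := by
          have h1 : ‖u - v‖ ≤ ‖v‖ + 1 := mem_closedBall_iff_norm.1 hu
          have := norm_le_norm_add_norm_sub' u v
          linarith
        have h2 : ‖A t u‖ ≤ C * (2 * ‖v‖ + 1) :=
          ((A t).le_of_opNorm_le (hAC t ht) u).trans (by gcongr)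
        refine (norm_add_le _ _).trans ((add_le_add h2 (hβD t ht)).trans ?_)
        show _ ≤ (2 * C + D) * (‖v‖ + 1)
        nlinarith [mul_nonneg hD hv]
      mul_max_le := by
        have : max (b - b) (b - a) = b - a := max_eq_right (by linarith)
        simp only [NNReal.coe_zero, sub_zero, this]
        change (2 * C + D) * (‖v‖ + 1) * (b - a) ≤ ‖v‖ + 1
        nlinarith }
  exact hPL.exists_eq_forall_mem_Icc_hasDerivWithinAt₀

/-- Uniqueness for linear ODEs with a final condition. -/
theorem linear_ode_solution_unique {A : ℝ → V →L[ℝ] V} {β : ℝ → V} {a b C : ℝ}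
    (hAC : ∀ t ∈ Icc a b, ‖A t‖ ≤ C) {Λ Λ' : ℝ → V}
    (hΛ : ∀ t ∈ Icc a b, HasDerivWithinAt Λ (A t (Λ t) + β t) (Icc a b) t)
    (hΛ' : ∀ t ∈ Icc a b, HasDerivWithinAt Λ' (A t (Λ' t) + β t) (Icc a b) t) (hb : Λ b = Λ' b) :
    EqOn Λ Λ' (Icc a b) := by
  refine ODE_solution_unique_of_mem_Icc_left (v := fun t u => A t u + β t) (s := fun _ => univ)
    (K := C.toNNReal) (fun t ht => LipschitzOnWith.of_dist_le_mul fun u _ u' _ => ?_)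
    (fun t ht => (hΛ t ht).continuousWithinAt)
    (fun t ht => (hΛ t (Ioc_subset_Icc_self ht)).Icc_to_Iic ht) (fun _ _ => mem_univ _)
    (fun t ht => (hΛ' t ht).continuousWithinAt)
    (fun t ht => (hΛ' t (Ioc_subset_Icc_self ht)).Icc_to_Iic ht) (fun _ _ => mem_univ _) hb
  rw [dist_add_right, dist_eq_norm, dist_eq_norm, ← map_sub]
  exact (A t).le_of_opNorm_le ((hAC t (Ioc_subset_Icc_self ht)).trans (Real.le_coe_toNNReal C)) _

end Analysis

/-! ### First-order expansion of the pairing in coordinates, and the adjoint equation under a change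
of coordinates. -/

section Sensitivity

variable {W E V : Type*} [NormedAddCommGroup W] [NormedSpace ℝ W] [NormedAddCommGroup E]
  [NormedSpace ℝ E] [NormedAddCommGroup V] [NormedSpace ℝ V]

/-- The partial derivative in the parameter. -/
def derivParam (g : W × ℝ × E → V) (z : W × ℝ × E) : W →L[ℝ] V :=
  fderiv ℝ (fun w => g (w, z.2)) z.1

/-- The partial derivative in the state. -/
def derivState (g : W × ℝ × E → V) (z : W × ℝ × E) : E →L[ℝ] V :=
  fderiv ℝ (fun u => g (z.1, z.2.1, u)) z.2.2

theorem derivParam_eq {g : W × ℝ × E → V} {z : W × ℝ × E} (hg : DifferentiableAt ℝ g z) :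
    derivParam g z = (fderiv ℝ g z).comp (ContinuousLinearMap.inl ℝ W (ℝ × E)) :=
  (hg.hasFDerivAt.comp z.1 (hasFDerivAt_prodMk_left z.1 z.2)).fderiv

theorem derivState_eq {g : W × ℝ × E → V} {z : W × ℝ × E} (hg : DifferentiableAt ℝ g z) :
    derivState g z = (fderiv ℝ g z).comp ((ContinuousLinearMap.inr ℝ W (ℝ × E)).comp
      (ContinuousLinearMap.inr ℝ ℝ E)) :=
  (hg.hasFDerivAt.comp z.2.2 ((hasFDerivAt_prodMk_right z.1 (z.2.1, z.2.2)).comp z.2.2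
    (hasFDerivAt_prodMk_right z.2.1 z.2.2))).fderiv

theorem fderiv_apply_eq {g : W × ℝ × E → V} {z : W × ℝ × E} (hg : DifferentiableAt ℝ g z)
    (dw : W) (du : E) : fderiv ℝ g z (dw, 0, du) = derivParam g z dw + derivState g z du := by
  rw [derivParam_eq hg, derivState_eq hg]
  simp [← map_add]

theorem continuousOn_derivParam {g : W × ℝ × E → V} {U : Set (W × ℝ × E)}
    (hg : ContDiffOn ℝ 1 g U) (hU : IsOpen U) : ContinuousOn (derivParam g) U :=
  ((hg.continuousOn_fderiv_of_isOpen hU le_rfl).clm_comp continuousOn_const).congr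
    fun _ hz => derivParam_eq ((hg.differentiableOn one_ne_zero).differentiableAt (hU.mem_nhds hz))

theorem continuousOn_derivState {g : W × ℝ × E → V} {U : Set (W × ℝ × E)}
    (hg : ContDiffOn ℝ 1 g U) (hU : IsOpen U) : ContinuousOn (derivState g) U :=
  ((hg.continuousOn_fderiv_of_isOpen hU le_rfl).clm_comp continuousOn_const).congr
    fun _ hz => derivState_eq ((hg.differentiableOn one_ne_zero).differentiableAt (hU.mem_nhds hz))

/-- The change of the pairing of an adjoint state with the displacement of a family of
solutions, to first order in the parameter. -/
theorem adjoint_pairing_isLittleO {G : W × ℝ × E → E} {ρ : W × ℝ × E → ℝ} {U : Set (W × ℝ × E)}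
    (hU : IsOpen U) (hG : ContDiffOn ℝ 1 G U) (hρ : ContDiffOn ℝ 1 ρ U) {a b : ℝ} (hab : a ≤ b)
    {w₀ : W} {X : ℝ → E} (hXU : ∀ t ∈ Icc a b, (w₀, t, X t) ∈ U)
    (hX : ∀ t ∈ Icc a b, HasDerivWithinAt X (G (w₀, t, X t)) (Icc a b) t)
    {Λ : ℝ → E →L[ℝ] ℝ}
    (hΛ : ∀ t ∈ Icc a b, HasDerivWithinAt Λ
      (-(Λ t).comp (derivState G (w₀, t, X t)) - derivState ρ (w₀, t, X t)) (Icc a b) t)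
    {Y : W → ℝ → E} {K : ℝ}
    (hYU : ∀ᶠ w in 𝓝 w₀, ∀ t ∈ Icc a b, (w, t, Y w t) ∈ U)
    (hY : ∀ᶠ w in 𝓝 w₀, ∀ t ∈ Icc a b, HasDerivWithinAt (Y w) (G (w, t, Y w t)) (Icc a b) t)
    (hYK : ∀ᶠ w in 𝓝 w₀, ∀ t ∈ Icc a b, ‖Y w t - X t‖ ≤ K * ‖w - w₀‖) :
    (fun w => Λ b (Y w b - X b) - Λ a (Y w a - X a)
      + (∫ t in a..b, (ρ (w, t, Y w t) - ρ (w₀, t, X t)))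
      - (∫ t in a..b, ((Λ t).comp (derivParam G (w₀, t, X t)) + derivParam ρ (w₀, t, X t)))
          (w - w₀)) =o[𝓝 w₀] fun w => w - w₀ := by
  have hXc : ContinuousOn X (Icc a b) := fun t ht => (hX t ht).continuousWithinAt
  have hΛc : ContinuousOn Λ (Icc a b) := fun t ht => (hΛ t ht).continuousWithinAt
  have hzc : ContinuousOn (fun t => (w₀, t, X t)) (Icc a b) :=
    continuousOn_const.prodMk (continuousOn_id.prodMk hXc)
  set κ := (fun t => (w₀, t, X t)) '' Icc a b with hκ
  have hκc : IsCompact κ := isCompact_Icc.image_of_continuousOn hzc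
  have hκU : κ ⊆ U := by
    rintro _ ⟨t, ht, rfl⟩
    exact hXU t ht
  obtain ⟨C, hC⟩ := isCompact_Icc.exists_bound_of_continuousOn hΛc
  have hC0 : 0 ≤ C := (norm_nonneg _).trans (hC a ⟨le_rfl, hab⟩)
  have hHc : ContinuousOn (fun t => (Λ t).comp (derivParam G (w₀, t, X t))
      + derivParam ρ (w₀, t, X t)) (Icc a b) :=
    (hΛc.clm_comp ((continuousOn_derivParam hG hU).comp hzc hXU)).add
      ((continuousOn_derivParam hρ hU).comp hzc hXU)
  have hGx : ContinuousOn (fun t => derivState G (w₀, t, X t)) (Icc a b) :=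
    (continuousOn_derivState hG hU).comp hzc hXU
  have hρx : ContinuousOn (fun t => derivState ρ (w₀, t, X t)) (Icc a b) :=
    (continuousOn_derivState hρ hU).comp hzc hXU
  have hint : ∀ {g : ℝ → ℝ}, ContinuousOn g (Icc a b) → IntervalIntegrable g volume a b :=
    fun hg => (hg.mono (uIcc_of_le hab).subset).intervalIntegrable
  have hHint : IntervalIntegrable (fun t => (Λ t).comp (derivParam G (w₀, t, X t))
      + derivParam ρ (w₀, t, X t)) volume a b :=
    (hHc.mono (uIcc_of_le hab).subset).intervalIntegrable
  refine isLittleO_iff.2 fun c hc => ?_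
  -- `L * ‖w - w₀‖` bounds the sup norm of the full increment `(w - w₀, 0, Y w t - X t)`.
  set L := max 1 K with hL
  have hL0 : 0 < L := lt_max_of_lt_left one_pos
  -- `C + 1` accounts for one Taylor remainder paired with `Λ` and one unpaired; `b - a + 1` keeps
  -- the denominator positive when `a = b`.
  set ε := c / ((C + 1) * L * (b - a + 1)) with hε_def
  have hba : 0 < b - a + 1 := by linarith
  have hε : 0 < ε := by positivity
  obtain ⟨δ, hδ, hGδ⟩ := hG.uniform_fderiv_of_isCompact hU hκc hκU hε
  obtain ⟨δ', hδ', hρδ⟩ := hρ.uniform_fderiv_of_isCompact hU hκc hκU hε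
  have hnear : ∀ᶠ w in 𝓝 w₀, ‖w - w₀‖ < min δ δ' / L := by
    have := Metric.ball_mem_nhds w₀ (div_pos (lt_min hδ hδ') hL0)
    filter_upwards [this] with w hw
    simpa [dist_eq_norm] using hw
  filter_upwards [hYU, hY, hYK, hnear] with w hwU hwY hwK hwn
  have hYc : ContinuousOn (Y w) (Icc a b) := fun t ht => (hwY t ht).continuousWithinAt
  have hzc' : ContinuousOn (fun t => (w, t, Y w t)) (Icc a b) :=
    continuousOn_const.prodMk (continuousOn_id.prodMk hYc)
  set N' : ℝ → ℝ := fun t =>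
    (-(Λ t).comp (derivState G (w₀, t, X t)) - derivState ρ (w₀, t, X t)) (Y w t - X t)
      + Λ t (G (w, t, Y w t) - G (w₀, t, X t)) with hN'
  have hN : ∀ t ∈ Icc a b,
      HasDerivWithinAt (fun t => Λ t (Y w t - X t)) (N' t) (Icc a b) t := fun t ht =>
    (hΛ t ht).clm_apply ((hwY t ht).sub (hX t ht))
  have hGc : ContinuousOn (fun t => G (w, t, Y w t) - G (w₀, t, X t)) (Icc a b) :=
    (hG.continuousOn.comp hzc' hwU).sub (hG.continuousOn.comp hzc hXU)
  have hρc : ContinuousOn (fun t => ρ (w, t, Y w t) - ρ (w₀, t, X t)) (Icc a b) :=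
    (hρ.continuousOn.comp hzc' hwU).sub (hρ.continuousOn.comp hzc hXU)
  have hN'c : ContinuousOn N' (Icc a b) :=
    (((hΛc.clm_comp hGx).neg.sub hρx).clm_apply (hYc.sub hXc)).add (hΛc.clm_apply hGc)
  have hFTC : ∫ t in a..b, N' t = Λ b (Y w b - X b) - Λ a (Y w a - X a) :=
    intervalIntegral.integral_eq_sub_of_hasDeriv_right_of_le hab
      (fun t ht => (hN t ht).continuousWithinAt)
      (fun t ht => ((hN t (Ioo_subset_Icc_self ht)).Icc_to_Ici
        (Ioo_subset_Ico_self ht)).mono Ioi_subset_Ici_self) (hint hN'c)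
  rw [← hFTC, ContinuousLinearMap.intervalIntegral_apply hHint,
    ← intervalIntegral.integral_add (hint hN'c) (hint hρc),
    ← intervalIntegral.integral_sub ((hint hN'c).add (hint hρc))
      (hint (hHc.clm_apply continuousOn_const))]
  have hbound : ∀ t ∈ Icc a b, ‖N' t + (ρ (w, t, Y w t) - ρ (w₀, t, X t))
      - ((Λ t).comp (derivParam G (w₀, t, X t)) + derivParam ρ (w₀, t, X t)) (w - w₀)‖
      ≤ (C + 1) * (ε * (L * ‖w - w₀‖)) := by
    intro t ht
    have hzt : ((w, t, Y w t) : W × ℝ × E) - (w₀, t, X t) = (w - w₀, 0, Y w t - X t) := by simp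
    have hzn : ‖((w, t, Y w t) : W × ℝ × E) - (w₀, t, X t)‖ ≤ L * ‖w - w₀‖ := by
      rw [hzt]
      simp only [Prod.norm_def, norm_zero]
      have h1 : ‖w - w₀‖ ≤ L * ‖w - w₀‖ :=
        le_mul_of_one_le_left (norm_nonneg _) (le_max_left _ _)
      have h2 : ‖Y w t - X t‖ ≤ L * ‖w - w₀‖ :=
        (hwK t ht).trans (mul_le_mul_of_nonneg_right (le_max_right _ _) (norm_nonneg _))
      exact max_le h1 (max_le (by positivity) h2)
    have hzδ : ‖((w, t, Y w t) : W × ℝ × E) - (w₀, t, X t)‖ < min δ δ' :=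
      hzn.trans_lt (by rwa [mul_comm, ← lt_div_iff₀ hL0])
    have hmem : (w₀, t, X t) ∈ κ := ⟨t, ht, rfl⟩
    have hnhds := hU.mem_nhds (hκU hmem)
    have b1 := (hGδ _ hmem _ (hzδ.trans_le (min_le_left _ _))).trans
      (mul_le_mul_of_nonneg_left hzn hε.le)
    have b2 := (hρδ _ hmem _ (hzδ.trans_le (min_le_right _ _))).trans
      (mul_le_mul_of_nonneg_left hzn hε.le)
    rw [hzt, fderiv_apply_eq ((hG.differentiableOn one_ne_zero).differentiableAt hnhds)] at b1
    rw [hzt, fderiv_apply_eq ((hρ.differentiableOn one_ne_zero).differentiableAt hnhds)] at b2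
    have b3 := (Λ t).le_of_opNorm_le_of_le (hC t ht) b1
    -- The adjoint equation does its work here: the state derivatives in `N'` are exactly those that
    -- complete the two differences to first-order Taylor remainders of `G` and `ρ`.
    have heq : N' t + (ρ (w, t, Y w t) - ρ (w₀, t, X t))
        - ((Λ t).comp (derivParam G (w₀, t, X t)) + derivParam ρ (w₀, t, X t)) (w - w₀)
        = Λ t (G (w, t, Y w t) - G (w₀, t, X t) - (derivParam G (w₀, t, X t) (w - w₀)
            + derivState G (w₀, t, X t) (Y w t - X t)))
          + (ρ (w, t, Y w t) - ρ (w₀, t, X t) - (derivParam ρ (w₀, t, X t) (w - w₀)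
            + derivState ρ (w₀, t, X t) (Y w t - X t))) := by
      simp only [hN', sub_apply, neg_apply,
        ContinuousLinearMap.comp_apply, add_apply, map_sub, map_add]
      ring
    rw [heq]
    refine (norm_add_le _ _).trans ((add_le_add b3 b2).trans (le_of_eq ?_))
    ring
  refine (intervalIntegral.norm_integral_le_of_norm_le_const fun t ht => hbound t
    (by rw [uIoc_of_le hab] at ht; exact Ioc_subset_Icc_self ht)).trans ?_
  rw [abs_of_nonneg (by linarith)]
  have : (C + 1) * (ε * (L * ‖w - w₀‖)) * (b - a) ≤ (C + 1) * (ε * (L * ‖w - w₀‖)) * (b - a + 1) :=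
    mul_le_mul_of_nonneg_left (by linarith) (by positivity)
  refine this.trans (le_of_eq ?_)
  rw [hε_def]
  field_simp

end Sensitivity

/-- Differentiating `g ∘ τ = Dτ · g'` gives `Dg ∘ Dτ = Dτ ∘ Dg' + D²τ(·)(g')`, while the product
rule for `Λ ∘ Dτ` along the curve produces `Λ ∘ D²τ(g')(·)`. The two second-order terms cancel by
symmetry of `D²τ`, which is why `τ` has to be of class C². -/
theorem adjoint_equation_transition {E : Type*} [NormedAddCommGroup E] [NormedSpace ℝ E]
    {τ g g' : E → E} {ρ ρ' : E → ℝ} {u₀ : E} (hτ : ContDiffAt ℝ 2 τ u₀)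
    (hg : DifferentiableAt ℝ g (τ u₀)) (hg' : DifferentiableAt ℝ g' u₀)
    (hρ : DifferentiableAt ℝ ρ (τ u₀))
    (hgτ : ∀ᶠ u in 𝓝 u₀, g (τ u) = fderiv ℝ τ u (g' u)) (hρτ : ∀ᶠ u in 𝓝 u₀, ρ (τ u) = ρ' u)
    {S : Set ℝ} {t : ℝ} {u : ℝ → E} (hut : u t = u₀) (hu : HasDerivWithinAt u (g' u₀) S t)
    {Λ : ℝ → E →L[ℝ] ℝ}
    (hΛ : HasDerivWithinAt Λ (-(Λ t).comp (fderiv ℝ g (τ u₀)) - fderiv ℝ ρ (τ u₀)) S t) :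
    HasDerivWithinAt (fun s => (Λ s).comp (fderiv ℝ τ (u s)))
      (-((Λ t).comp (fderiv ℝ τ u₀)).comp (fderiv ℝ g' u₀) - fderiv ℝ ρ' u₀) S t := by
  subst hut
  have hτ1 : HasFDerivAt τ (fderiv ℝ τ (u t)) (u t) :=
    (hτ.differentiableAt two_ne_zero).hasFDerivAt
  have hτ2 : HasFDerivAt (fderiv ℝ τ) (fderiv ℝ (fderiv ℝ τ) (u t)) (u t) :=
    ((hτ.fderiv_right (m := 1) (by norm_num)).differentiableAt one_ne_zero).hasFDerivAt
  have hsymm : IsSymmSndFDerivAt ℝ τ (u t) := hτ.isSymmSndFDerivAt (by simp)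
  have e1 : (fderiv ℝ g (τ (u t))).comp (fderiv ℝ τ (u t))
      = (fderiv ℝ τ (u t)).comp (fderiv ℝ g' (u t))
        + (fderiv ℝ (fderiv ℝ τ) (u t)).flip (g' (u t)) :=
    (hg.hasFDerivAt.comp (u t) hτ1).unique
      ((hτ2.clm_apply hg'.hasFDerivAt).congr_of_eventuallyEq hgτ)
  have e2 : (fderiv ℝ ρ (τ (u t))).comp (fderiv ℝ τ (u t)) = fderiv ℝ ρ' (u t) :=
    (((hρ.hasFDerivAt.comp (u t) hτ1).congr_of_eventuallyEq
      (hρτ.mono fun _ h => h.symm)).fderiv).symm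
  have hd := hΛ.clm_comp (hτ2.comp_hasDerivWithinAt t hu)
  refine hd.congr_deriv ?_
  ext v
  have e1v := congrArg (Λ t) (DFunLike.congr_fun e1 v)
  have e2v := DFunLike.congr_fun e2 v
  have e3 := hsymm v (g' (u t))
  simp only [ContinuousLinearMap.comp_apply, add_apply, ContinuousLinearMap.flip_apply,
    map_add] at e1v e2v
  simp only [ContinuousLinearMap.comp_apply, add_apply, sub_apply, neg_apply, Function.comp_apply, e1v, e2v,
    ← e3]
  ring

/-! ### Coordinate representations of vector fields, costs and covectors. -/

section Charts

set_option linter.unusedSectionVars false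

variable {n p : ℕ} {M : Type*} [TopologicalSpace M] [ChartedSpace (EuclideanSpace ℝ (Fin n)) M]
  {P : Type*} [TopologicalSpace P] [ChartedSpace (EuclideanSpace ℝ (Fin p)) P]
  {φ : OpenPartialHomeomorph P (EuclideanSpace ℝ (Fin p))}
  {e e' : OpenPartialHomeomorph M (EuclideanSpace ℝ (Fin n))}
  {f : P → ℝ → (x : M) → TangentSpace (𝓡 n) x} {r : M → P → ℝ → ℝ}

/-- The differential of a chart as a map of the model space. -/
def chartDeriv (e : OpenPartialHomeomorph M (EuclideanSpace ℝ (Fin n))) (m : M) :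
    EuclideanSpace ℝ (Fin n) →L[ℝ] EuclideanSpace ℝ (Fin n) :=
  mfderiv (𝓡 n) (𝓡 n) e m

/-- The coordinate representation of a covector. -/
def coRep (e : OpenPartialHomeomorph M (EuclideanSpace ℝ (Fin n))) (m : M)
    (l : EuclideanSpace ℝ (Fin n) →L[ℝ] ℝ) : EuclideanSpace ℝ (Fin n) →L[ℝ] ℝ :=
  l.comp (chartDeriv e m).inverse

/-- The coordinate representation of a vector field in charts of state and parameter. -/
def localField (φ : OpenPartialHomeomorph P (EuclideanSpace ℝ (Fin p)))
    (e : OpenPartialHomeomorph M (EuclideanSpace ℝ (Fin n)))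
    (f : P → ℝ → (x : M) → TangentSpace (𝓡 n) x)
    (z : EuclideanSpace ℝ (Fin p) × ℝ × EuclideanSpace ℝ (Fin n)) : EuclideanSpace ℝ (Fin n) :=
  chartDeriv e (e.symm z.2.2) (f (φ.symm z.1) z.2.1 (e.symm z.2.2))

/-- The coordinate representation of a running cost in charts of state and parameter. -/
def localCost (φ : OpenPartialHomeomorph P (EuclideanSpace ℝ (Fin p)))
    (e : OpenPartialHomeomorph M (EuclideanSpace ℝ (Fin n))) (r : M → P → ℝ → ℝ)
    (z : EuclideanSpace ℝ (Fin p) × ℝ × EuclideanSpace ℝ (Fin n)) : ℝ :=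
  r (e.symm z.2.2) (φ.symm z.1) z.2.1

/-- The domain of the coordinate representations. -/
def chartDomain (φ : OpenPartialHomeomorph P (EuclideanSpace ℝ (Fin p)))
    (e : OpenPartialHomeomorph M (EuclideanSpace ℝ (Fin n))) :
    Set (EuclideanSpace ℝ (Fin p) × ℝ × EuclideanSpace ℝ (Fin n)) :=
  φ.target ×ˢ univ ×ˢ e.target

theorem isOpen_chartDomain : IsOpen (chartDomain φ e) :=
  φ.open_target.prod (isOpen_univ.prod e.open_target)

theorem contMDiffOn_param_symm [IsManifold (𝓡 p) ∞ P]
    (hφ : φ ∈ IsManifold.maximalAtlas (𝓡 p) ∞ P) :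
    ContMDiffOn 𝓘(ℝ, EuclideanSpace ℝ (Fin p) × ℝ × EuclideanSpace ℝ (Fin n)) (𝓡 p) 1
      (fun z => φ.symm z.1) (chartDomain φ e) :=
  ((contMDiffOn_symm_of_mem_maximalAtlas hφ).of_le (by simp)).comp
    contDiff_fst.contMDiff.contMDiffOn fun _ hz => hz.1

theorem contMDiffOn_state_symm [IsManifold (𝓡 n) ∞ M]
    (he : e ∈ IsManifold.maximalAtlas (𝓡 n) ∞ M) :
    ContMDiffOn 𝓘(ℝ, EuclideanSpace ℝ (Fin p) × ℝ × EuclideanSpace ℝ (Fin n)) (𝓡 n) 1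
      (fun z => e.symm z.2.2) (chartDomain φ e) :=
  ((contMDiffOn_symm_of_mem_maximalAtlas he).of_le (by simp)).comp
    (contDiff_snd.comp contDiff_snd).contMDiff.contMDiffOn fun _ hz => hz.2.2

theorem contMDiffOn_time :
    ContMDiffOn 𝓘(ℝ, EuclideanSpace ℝ (Fin p) × ℝ × EuclideanSpace ℝ (Fin n)) 𝓘(ℝ, ℝ) 1
      (fun z => z.2.1) (chartDomain φ e) :=
  (contDiff_fst.comp contDiff_snd).contMDiff.contMDiffOn

variable [IsManifold (𝓡 n) ∞ M] [IsManifold (𝓡 p) ∞ P]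

theorem contDiffOn_localCost (hφ : φ ∈ IsManifold.maximalAtlas (𝓡 p) ∞ P)
    (he : e ∈ IsManifold.maximalAtlas (𝓡 n) ∞ M)
    (hr : ContMDiff ((𝓡 n).prod ((𝓡 p).prod 𝓘(ℝ, ℝ))) 𝓘(ℝ, ℝ) 1
      (fun q : M × P × ℝ => r q.1 q.2.1 q.2.2)) :
    ContDiffOn ℝ 1 (localCost φ e r) (chartDomain φ e) :=
  contMDiffOn_iff_contDiffOn.1 <| hr.comp_contMDiffOn
    ((contMDiffOn_state_symm he).prodMk ((contMDiffOn_param_symm hφ).prodMk contMDiffOn_time))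

/-- The coordinate field is the fibre component of the tangent map of the chart applied to the
section. The tangent map loses one derivative, which a smooth chart can afford. -/
theorem contDiffOn_localField (hφ : φ ∈ IsManifold.maximalAtlas (𝓡 p) ∞ P)
    (he : e ∈ IsManifold.maximalAtlas (𝓡 n) ∞ M)
    (hf : ContMDiff ((𝓡 p).prod (𝓘(ℝ, ℝ).prod (𝓡 n))) (𝓡 n).tangent 1
      (fun q : P × ℝ × M => (⟨q.2.2, f q.1 q.2.1 q.2.2⟩ : TangentBundle (𝓡 n) M))) :
    ContDiffOn ℝ 1 (localField φ e f) (chartDomain φ e) := by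
  have : IsManifold (𝓡 n) 1 M := .of_le (n := ∞) (by simp)
  have h1 : ContMDiffOn 𝓘(ℝ, EuclideanSpace ℝ (Fin p) × ℝ × EuclideanSpace ℝ (Fin n))
      (𝓡 n).tangent 1 (fun z => (⟨e.symm z.2.2, f (φ.symm z.1) z.2.1 (e.symm z.2.2)⟩ :
        TangentBundle (𝓡 n) M)) (chartDomain φ e) :=
    hf.comp_contMDiffOn
      ((contMDiffOn_param_symm hφ).prodMk (contMDiffOn_time.prodMk (contMDiffOn_state_symm he)))
  have h2 : ContMDiffOn (𝓡 n).tangent (𝓡 n).tangent 1 (tangentMapWithin (𝓡 n) (𝓡 n) e e.source)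
      (Bundle.TotalSpace.proj ⁻¹' e.source) :=
    (contMDiffOn_of_mem_maximalAtlas he).contMDiffOn_tangentMapWithin (by rw [one_add_one_eq_two]; exact ENat.LEInfty.out)
      e.open_source.uniqueMDiffOn
  have h3 := h2.comp h1 (fun z hz => e.map_target hz.2.2)
  have h4 := (contMDiff_snd_tangentBundle_modelSpace (EuclideanSpace ℝ (Fin n)) (𝓡 n)
    (n := 1)).comp_contMDiffOn h3
  refine contMDiffOn_iff_contDiffOn.1 (h4.congr fun z hz => ?_)
  exact DFunLike.congr_fun (mfderivWithin_of_isOpen e.open_source (e.map_target hz.2.2)).symm _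

omit [IsManifold (𝓡 p) ∞ P]

theorem mdifferentiableAt_chart (he : e ∈ IsManifold.maximalAtlas (𝓡 n) ∞ M) {m : M}
    (hm : m ∈ e.source) : MDifferentiableAt (𝓡 n) (𝓡 n) e m :=
  (contMDiffAt_of_mem_maximalAtlas he hm).mdifferentiableAt (by simp)

theorem chart_mdifferentiable (he : e ∈ IsManifold.maximalAtlas (𝓡 n) ∞ M) :
    e.MDifferentiable (𝓡 n) (𝓡 n) :=
  ⟨(contMDiffOn_of_mem_maximalAtlas he).mdifferentiableOn (by simp),
    (contMDiffOn_symm_of_mem_maximalAtlas he).mdifferentiableOn (by simp)⟩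

theorem isInvertible_chartDeriv (he : e ∈ IsManifold.maximalAtlas (𝓡 n) ∞ M) {m : M}
    (hm : m ∈ e.source) : (chartDeriv e m).IsInvertible :=
  have : IsManifold (𝓡 n) 1 M := .of_le (n := ∞) (by simp)
  ⟨(chart_mdifferentiable he).mfderiv hm, rfl⟩

theorem coRep_comp_chartDeriv (he : e ∈ IsManifold.maximalAtlas (𝓡 n) ∞ M) {m : M}
    (hm : m ∈ e.source) (l : EuclideanSpace ℝ (Fin n) →L[ℝ] ℝ) :
    (coRep e m l).comp (chartDeriv e m) = l := by
  rw [coRep, ContinuousLinearMap.comp_assoc, (isInvertible_chartDeriv he hm).inverse_comp_self,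
    ContinuousLinearMap.comp_id]

theorem coRep_comp_self (he : e ∈ IsManifold.maximalAtlas (𝓡 n) ∞ M) {m : M}
    (hm : m ∈ e.source) (Λ : EuclideanSpace ℝ (Fin n) →L[ℝ] ℝ) :
    coRep e m (Λ.comp (chartDeriv e m)) = Λ := by
  rw [coRep, ContinuousLinearMap.comp_assoc, (isInvertible_chartDeriv he hm).self_comp_inverse,
    ContinuousLinearMap.comp_id]

/-- The tangent space at `m` is the model space as seen through the preferred chart at `m`. A
covector is therefore its own representation there, so it can be paired directly with a displacement
measured in that chart. -/
theorem chartDeriv_chartAt_self (m : M) :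
    chartDeriv (chartAt (EuclideanSpace ℝ (Fin n)) m) m = ContinuousLinearMap.id ℝ _ := by
  have : IsManifold (𝓡 n) 1 M := .of_le (n := ∞) (by simp)
  ext1 v
  rw [chartDeriv, mfderiv_chartAt_eq_tangentCoordChange (mem_chart_source _ m)]
  exact tangentCoordChange_self (by simp)

theorem coRep_chartAt_self (m : M) (l : EuclideanSpace ℝ (Fin n) →L[ℝ] ℝ) :
    coRep (chartAt (EuclideanSpace ℝ (Fin n)) m) m l = l := by
  rw [coRep, chartDeriv_chartAt_self, ContinuousLinearMap.inverse_id, ContinuousLinearMap.comp_id]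

/-- Points near a common point of two charts lie in the domain of the transition map. -/
theorem transition_source_mem_nhds {m : M} (hm : m ∈ e.source) (hm' : m ∈ e'.source) :
    ∀ᶠ u in 𝓝 (e' m), u ∈ e'.target ∧ e'.symm u ∈ e.source := by
  have h := (e'.symm.trans e).open_source.mem_nhds (x := e' m) (by simp [hm, hm'])
  filter_upwards [h] with u hu
  simpa using hu

theorem contDiffAt_transition (he : e ∈ IsManifold.maximalAtlas (𝓡 n) ∞ M)
    (he' : e' ∈ IsManifold.maximalAtlas (𝓡 n) ∞ M) {m : M} (hm : m ∈ e.source)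
    (hm' : m ∈ e'.source) : ContDiffAt ℝ ∞ (e ∘ e'.symm) (e' m) := by
  refine contMDiffAt_iff_contDiffAt.1 (ContMDiffAt.comp (I' := 𝓡 n) (e' m) ?_
    (contMDiffAt_symm_of_mem_maximalAtlas he' (e'.map_source hm')))
  rw [e'.left_inv hm']
  exact contMDiffAt_of_mem_maximalAtlas he hm

theorem fderiv_transition_comp (he : e ∈ IsManifold.maximalAtlas (𝓡 n) ∞ M)
    (he' : e' ∈ IsManifold.maximalAtlas (𝓡 n) ∞ M) {m : M} (hm : m ∈ e.source)
    (hm' : m ∈ e'.source) :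
    (fderiv ℝ (e ∘ e'.symm) (e' m)).comp (chartDeriv e' m) = chartDeriv e m := by
  have h1 : HasMFDerivAt (𝓡 n) (𝓡 n) (e ∘ e'.symm) (e' m) (fderiv ℝ (e ∘ e'.symm) (e' m)) :=
    ((contDiffAt_transition he he' hm hm').differentiableAt (by simp)).hasFDerivAt.hasMFDerivAt
  have h2 := h1.comp m (mdifferentiableAt_chart he' hm').hasMFDerivAt
  have h3 := h2.congr_of_eventuallyEq (f₁ := e) (by
    filter_upwards [e'.open_source.mem_nhds hm'] with y hy
    simp [e'.left_inv hy])
  exact h3.mfderiv.symm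

theorem coRep_transition (he : e ∈ IsManifold.maximalAtlas (𝓡 n) ∞ M)
    (he' : e' ∈ IsManifold.maximalAtlas (𝓡 n) ∞ M) {m : M} (hm : m ∈ e.source)
    (hm' : m ∈ e'.source) (l : EuclideanSpace ℝ (Fin n) →L[ℝ] ℝ) :
    coRep e' m l = (coRep e m l).comp (fderiv ℝ (e ∘ e'.symm) (e' m)) := by
  have h := fderiv_transition_comp he he' hm hm'
  conv_lhs => rw [← coRep_comp_chartDeriv he hm l, ← h, ← ContinuousLinearMap.comp_assoc]
  exact coRep_comp_self he' hm' _

omit [ChartedSpace (EuclideanSpace ℝ (Fin p)) P] in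
theorem localField_transition (he : e ∈ IsManifold.maximalAtlas (𝓡 n) ∞ M)
    (he' : e' ∈ IsManifold.maximalAtlas (𝓡 n) ∞ M) {u : EuclideanSpace ℝ (Fin n)}
    (hu : u ∈ e'.target) (hu' : e'.symm u ∈ e.source) (w : EuclideanSpace ℝ (Fin p)) (t : ℝ) :
    localField φ e f (w, t, (e ∘ e'.symm) u)
      = fderiv ℝ (e ∘ e'.symm) u (localField φ e' f (w, t, u)) := by
  have h := fderiv_transition_comp he he' hu' (e'.map_target hu)
  rw [e'.right_inv hu] at h
  -- The type of `f _ t m` depends on `m`, so the base point is varied through an equation instead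
  -- of being rewritten in place.
  have key : ∀ m, m = e'.symm u → chartDeriv e m (f (φ.symm w) t m)
      = fderiv ℝ (e ∘ e'.symm) u (localField φ e' f (w, t, u)) := by
    rintro _ rfl
    rw [← h]
    rfl
  exact key _ (e.left_inv hu')

/-- Solutions in coordinates. -/
theorem hasDerivWithinAt_chart (he : e ∈ IsManifold.maximalAtlas (𝓡 n) ∞ M) {x : ℝ → M}
    {s : Set ℝ} {t : ℝ} (ht : x t ∈ e.source) {v : TangentSpace (𝓡 n) (x t)}
    (hx : HasMFDerivWithinAt 𝓘(ℝ, ℝ) (𝓡 n) x s t (ContinuousLinearMap.toSpanSingleton ℝ v)) :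
    HasDerivWithinAt (fun s => e (x s)) (chartDeriv e (x t) v) s t := by
  have h1 := (mdifferentiableAt_chart he ht).hasMFDerivAt.comp_hasMFDerivWithinAt t hx
  have h2 : HasFDerivWithinAt (fun s => e (x s)) ((chartDeriv e (x t)).comp
      (ContinuousLinearMap.toSpanSingleton ℝ (show EuclideanSpace ℝ (Fin n) from v))) s t :=
    h1.hasFDerivWithinAt
  refine h2.hasDerivWithinAt.congr_deriv ?_
  rw [ContinuousLinearMap.comp_apply, ContinuousLinearMap.toSpanSingleton_apply, one_smul]

end Charts

/-! ### Confinement of nearby solutions to a chart, uniqueness, and the flow. -/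

section Curves

set_option linter.unusedSectionVars false

variable {n p : ℕ} {M : Type*} [TopologicalSpace M] [ChartedSpace (EuclideanSpace ℝ (Fin n)) M]
  {P : Type*} [TopologicalSpace P] [ChartedSpace (EuclideanSpace ℝ (Fin p)) P]
  {φ : OpenPartialHomeomorph P (EuclideanSpace ℝ (Fin p))}
  {e e' : OpenPartialHomeomorph M (EuclideanSpace ℝ (Fin n))}
  {f : P → ℝ → (x : M) → TangentSpace (𝓡 n) x} {r : M → P → ℝ → ℝ}

/-- `x` satisfies `x' = f_θ(x, t)` on `s`. -/
def IsIntegralOn (f : P → ℝ → (x : M) → TangentSpace (𝓡 n) x) (θ : P) (s : Set ℝ)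
    (x : ℝ → M) : Prop :=
  ∀ t ∈ s, HasMFDerivWithinAt 𝓘(ℝ, ℝ) (𝓡 n) x s t
    (ContinuousLinearMap.toSpanSingleton ℝ (f θ t (x t)))

theorem IsIntegralOn.mono {θ : P} {s s' : Set ℝ} {x : ℝ → M} (h : IsIntegralOn f θ s x)
    (hs : s' ⊆ s) : IsIntegralOn f θ s' x := fun t ht => (h t (hs ht)).mono hs

theorem IsIntegralOn.continuousOn {θ : P} {s : Set ℝ} {x : ℝ → M} (h : IsIntegralOn f θ s x) :
    ContinuousOn x s := fun t ht => (h t ht).continuousWithinAt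

variable [IsManifold (𝓡 n) ∞ M]

theorem IsIntegralOn.hasDerivWithinAt_chart {w : EuclideanSpace ℝ (Fin p)} {s : Set ℝ} {x : ℝ → M}
    (h : IsIntegralOn f (φ.symm w) s x) (he : e ∈ IsManifold.maximalAtlas (𝓡 n) ∞ M) {t : ℝ}
    (ht : t ∈ s) (hx : x t ∈ e.source) :
    HasDerivWithinAt (fun s => e (x s)) (localField φ e f (w, t, e (x t))) s t := by
  have key : ∀ m, m = x t → chartDeriv e m (f (φ.symm w) t m)
      = chartDeriv e (x t) (f (φ.symm w) t (x t)) := by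
    rintro _ rfl
    rfl
  exact (AdjointMethod.hasDerivWithinAt_chart he hx (h t ht)).congr_deriv
    (key _ (e.left_inv hx)).symm

variable [IsManifold (𝓡 p) ∞ P]

/-- Solutions for nearby parameters and initial values stay close to a given solution in a chart,
on a short time interval. -/
theorem exists_tube [T2Space M] (hφ : φ ∈ IsManifold.maximalAtlas (𝓡 p) ∞ P)
    (he : e ∈ IsManifold.maximalAtlas (𝓡 n) ∞ M)
    (hf : ContMDiff ((𝓡 p).prod (𝓘(ℝ, ℝ).prod (𝓡 n))) (𝓡 n).tangent 1
      (fun q : P × ℝ × M => (⟨q.2.2, f q.1 q.2.1 q.2.2⟩ : TangentBundle (𝓡 n) M)))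
    {w₀ : EuclideanSpace ℝ (Fin p)} (hw₀ : w₀ ∈ φ.target) {T : ℝ} {x : ℝ → M}
    (hx : IsIntegralOn f (φ.symm w₀) (Icc 0 T) x) {t₀ : ℝ} (ht₀ : t₀ ∈ Icc 0 T)
    (hxt₀ : x t₀ ∈ e.source) :
    ∃ K > 0, ∃ ε > 0, ∃ δ > 0, ∀ a b, 0 ≤ a → a ≤ b → b ≤ T → t₀ - ε < a → b < t₀ + ε →
      (∀ t ∈ Icc a b, x t ∈ e.source) ∧ ∀ w, ‖w - w₀‖ < δ → w ∈ φ.target ∧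
        ∀ y, IsIntegralOn f (φ.symm w) (Icc a b) y → y a ∈ e.source → ‖e (y a) - e (x a)‖ < δ →
          ∀ t ∈ Icc a b, y t ∈ e.source ∧
            ‖e (y t) - e (x t)‖ ≤ K * (‖e (y a) - e (x a)‖ + ‖w - w₀‖) := by
  set u₀ := e (x t₀) with hu₀
  have hdom : chartDomain φ e ∈ 𝓝 (w₀, t₀, u₀) :=
    isOpen_chartDomain.mem_nhds ⟨hw₀, mem_univ _, e.map_source hxt₀⟩
  obtain ⟨K₀, V, hV, hLip⟩ :=
    ((contDiffOn_localField hφ he hf).contDiffAt hdom).exists_lipschitzOnWith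
  obtain ⟨η, hη, hball⟩ := Metric.mem_nhds_iff.1 (inter_mem hV hdom)
  have hmem : ∀ {w t u}, ‖w - w₀‖ < η → |t - t₀| < η → ‖u - u₀‖ < η →
      (w, t, u) ∈ V ∩ chartDomain φ e := fun h1 h2 h3 => hball (by
    rw [Metric.mem_ball, Prod.dist_eq, Prod.dist_eq, dist_eq_norm, dist_eq_norm, dist_eq_norm]
    exact max_lt h1 (max_lt (by simpa using h2) h3))
  have hec : ContinuousWithinAt (fun t => e (x t)) (Icc 0 T) t₀ :=
    (e.continuousAt hxt₀).comp_continuousWithinAt (hx.continuousOn t₀ ht₀)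
  have hxe : ∀ᶠ t in 𝓝[Icc 0 T] t₀, x t ∈ e.source ∧ ‖e (x t) - u₀‖ < η / 4 := by
    have h1 := (hx.continuousOn t₀ ht₀).eventually (e.open_source.mem_nhds hxt₀)
    have h2 := hec.eventually (Metric.ball_mem_nhds u₀ (by positivity : 0 < η / 4))
    filter_upwards [h1, h2] with t h1 h2
    exact ⟨h1, by simpa [dist_eq_norm] using h2⟩
  obtain ⟨ε', hε', hxε⟩ := Metric.eventually_nhds_iff.1 (eventually_nhdsWithin_iff.1 hxe)
  -- Time intervals are then shorter than `2 * ε`, which fixes the Grönwall factor `K`, and their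
  -- times lie in the Lipschitz neighbourhood.
  set ε := min ε' η with hε_def
  have hε : 0 < ε := lt_min hε' hη
  set K := Real.exp (K₀ * (2 * ε)) with hK
  have hK1 : 1 ≤ K := Real.one_le_exp (by positivity)
  have hK0 : 0 < K := by positivity
  -- Initial and parameter errors below `δ` give a distance at most η / 4 from `x`, and `x` stays
  -- within η / 4 of `u₀`; so `y` stays within η / 2, well inside the ball of radius `η`.
  set δ := η / (8 * K) with hδ_def
  have hδ : 0 < δ := by positivity
  have hKδ : K * δ = η / 8 := by rw [hδ_def]; field_simp
  have hδη : δ ≤ η / 8 := by nlinarith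
  refine ⟨K, hK0, ε, hε, δ, hδ, fun a b ha hab hb haε hbε => ?_⟩
  have htime : ∀ t ∈ Icc a b, |t - t₀| < ε := fun t ht =>
    abs_lt.2 ⟨by linarith [ht.1], by linarith [ht.2]⟩
  have hxs : ∀ t ∈ Icc a b, x t ∈ e.source ∧ ‖e (x t) - u₀‖ < η / 4 := fun t ht =>
    hxε (by rw [Real.dist_eq]; exact (htime t ht).trans_le (min_le_left _ _))
      ⟨ha.trans ht.1, ht.2.trans hb⟩
  refine ⟨fun t ht => (hxs t ht).1, fun w hw => ⟨(hmem (hw.trans_le (by linarith))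
    (t := t₀) (u := u₀) (by simpa using hη) (by simpa using hη)).2.1, fun y hy hya hyδ => ?_⟩⟩
  have haI : a ∈ Icc a b := ⟨le_rfl, hab⟩
  set B := e.source ∩ e ⁻¹' Metric.ball u₀ η with hB
  have hestimate : ∀ t ∈ Icc a b, (∀ s ∈ Icc a t, y s ∈ B) →
      ‖e (y t) - e (x t)‖ ≤ K * (‖e (y a) - e (x a)‖ + ‖w - w₀‖) := by
    intro t ht hyB
    have hsub : Icc a t ⊆ Icc a b := Icc_subset_Icc_right ht.2
    have hyη : ∀ s ∈ Icc a t, ‖e (y s) - u₀‖ < η := fun s hs => by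
      simpa [dist_eq_norm] using (hyB s hs).2
    have hsη : ∀ s ∈ Icc a t, |s - t₀| < η := fun s hs =>
      (htime s (hsub hs)).trans_le (min_le_right _ _)
    have hwη : ‖w - w₀‖ < η := hw.trans_le (by linarith)
    have h := norm_sub_le_of_param_ode hLip (X := fun s => e (x s)) (Y := fun s => e (y s))
      (w₀ := w₀) (w := w) (a := a) (b := t)
      (fun s hs => (hx.mono fun s hs => ⟨ha.trans hs.1, (hsub hs).2.trans hb⟩).hasDerivWithinAt_chart
        he hs (hxs s (hsub hs)).1)
      (fun s hs => (hy.mono hsub).hasDerivWithinAt_chart he hs (hyB s hs).1)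
      (fun s hs => (hmem (by simpa using hη) (hsη s hs)
        ((hxs s (hsub hs)).2.trans (by linarith))).1)
      (fun s hs => (hmem hwη (hsη s hs) (hyη s hs)).1)
      (fun s hs => (hmem (by simpa using hη) (hsη s hs) (hyη s hs)).1) t ⟨ht.1, le_rfl⟩
    rw [mul_comm K]
    refine h.trans (mul_le_mul_of_nonneg_left ?_ (by positivity))
    rw [hK]
    gcongr
    linarith [ht.2]
  have hsmall : K * (‖e (y a) - e (x a)‖ + ‖w - w₀‖) ≤ η / 4 := by nlinarith
  -- This set is compact, hence closed because `M` is Hausdorff. Without that, a curve could leave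
  -- the chart domain while its coordinates converge inside the target.
  set C := e.symm '' Metric.closedBall u₀ (η / 2) with hC_def
  have htarget : Metric.closedBall u₀ (η / 2) ⊆ e.target := fun u hu =>
    (hmem (w := w₀) (t := t₀) (by simpa using hη) (by simpa using hη)
      ((mem_closedBall_iff_norm.1 hu).trans_lt (by linarith))).2.2.2
  have hC : IsClosed C := ((isCompact_closedBall u₀ (η / 2)).image_of_continuousOn
    (e.continuousOn_symm.mono htarget)).isClosed
  have hCB : C ⊆ B := by
    rintro _ ⟨u, hu, rfl⟩
    refine ⟨e.map_target (htarget hu), ?_⟩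
    rw [mem_preimage, e.right_inv (htarget hu)]
    exact Metric.closedBall_subset_ball (by linarith) hu
  have hyaB : y a ∈ B := ⟨hya, by
    rw [mem_preimage, mem_ball_iff_norm]
    have := norm_sub_le_norm_sub_add_norm_sub (e (y a)) (e (x a)) u₀
    linarith [(hxs a haI).2]⟩
  have hall : ∀ t ∈ Icc a b, y t ∈ B := by
    refine mem_of_forall_mem_closed hy.continuousOn (e.isOpen_inter_preimage Metric.isOpen_ball) hC
      hCB hyaB fun t ht hyB => ?_
    have h1 := hestimate t ht hyB
    have h2 := norm_sub_le_norm_sub_add_norm_sub (e (y t)) (e (x t)) u₀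
    refine ⟨e (y t), mem_closedBall_iff_norm.2 (by linarith [(hxs t ht).2]),
      e.left_inv (hyB t ⟨ht.1, le_rfl⟩).1⟩
  exact fun t ht => ⟨(hall t ht).1,
    hestimate t ht fun s hs => hall s (Icc_subset_Icc_right ht.2 hs)⟩

theorem chartAt_mem_maximalAtlas {k : ℕ} {N : Type*} [TopologicalSpace N]
    [ChartedSpace (EuclideanSpace ℝ (Fin k)) N] [IsManifold (𝓡 k) ∞ N] (q : N) :
    chartAt (EuclideanSpace ℝ (Fin k)) q ∈ IsManifold.maximalAtlas (𝓡 k) ∞ N :=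
  IsManifold.chart_mem_maximalAtlas q

/-- Solutions on a Hausdorff manifold are unique. -/
theorem IsIntegralOn.eqOn [T2Space M]
    (hf : ContMDiff ((𝓡 p).prod (𝓘(ℝ, ℝ).prod (𝓡 n))) (𝓡 n).tangent 1
      (fun q : P × ℝ × M => (⟨q.2.2, f q.1 q.2.1 q.2.2⟩ : TangentBundle (𝓡 n) M)))
    {θ : P} {T : ℝ} (hT : 0 ≤ T) {x y : ℝ → M} (hx : IsIntegralOn f θ (Icc 0 T) x)
    (hy : IsIntegralOn f θ (Icc 0 T) y) (h0 : y 0 = x 0) : EqOn y x (Icc 0 T) := by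
  set φ := chartAt (EuclideanSpace ℝ (Fin p)) θ
  have hθ : φ.symm (φ θ) = θ := φ.left_inv (mem_chart_source _ θ)
  refine interval_induction (R := fun a b => y a = x a → EqOn y x (Icc a b)) hT ?_ ?_ h0
  · intro s t u _ hst htu _ h1 h2 hs
    rw [← Icc_union_Icc_eq_Icc hst htu]
    exact (h1 hs).union (h2 (h1 hs ⟨hst, le_rfl⟩))
  · intro t₀ ht₀
    set e := chartAt (EuclideanSpace ℝ (Fin n)) (x t₀)
    obtain ⟨K, hK, ε, hε, δ, hδ, h⟩ := exists_tube (φ := φ) (e := e)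
      (chartAt_mem_maximalAtlas θ) (chartAt_mem_maximalAtlas _) hf
      (φ.map_source (mem_chart_source _ θ)) (T := T) (x := x) (by rwa [hθ]) ht₀
      (mem_chart_source _ _)
    refine ⟨ε, hε, fun a b ha hab hb haε hbε hya t ht => ?_⟩
    obtain ⟨hxs, h⟩ := h a b ha hab hb haε hbε
    obtain ⟨hyt, hle⟩ := (h (φ θ) (by simpa using hδ)).2 y
      (by rw [hθ]; exact hy.mono (Icc_subset_Icc ha hb)) (hya ▸ hxs a ⟨le_rfl, hab⟩)
      (by rw [hya]; simpa using hδ) t ht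
    -- With equal parameters and equal starting points the tube estimate has right-hand side zero.
    rw [hya, sub_self, sub_self, norm_zero, norm_zero, add_zero, mul_zero] at hle
    exact e.injOn hyt (hxs t ht) (sub_eq_zero.1 (norm_le_zero_iff.1 hle))

/-- `flow` chooses a possibly different curve for every `t`; uniqueness forces each choice to agree
with the one given solution. -/
theorem flow_eq [T2Space M]
    (hf : ContMDiff ((𝓡 p).prod (𝓘(ℝ, ℝ).prod (𝓡 n))) (𝓡 n).tangent 1
      (fun q : P × ℝ × M => (⟨q.2.2, f q.1 q.2.1 q.2.2⟩ : TangentBundle (𝓡 n) M)))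
    {θ : P} {T : ℝ} {x₀ : M} {x : ℝ → M} (hx : IsSolutionOn f θ x₀ (Icc 0 T) x) {t : ℝ}
    (ht : t ∈ Icc 0 T) : flow f θ t x₀ = x t := by
  have hsub : uIcc 0 t ⊆ Icc 0 T := by
    rw [uIcc_of_le ht.1]
    exact Icc_subset_Icc_right ht.2
  have hex : ∃ x : ℝ → M, IsSolutionOn f θ x₀ (uIcc 0 t) x :=
    ⟨x, hx.1, fun s hs => (hx.2 s (hsub hs)).mono hsub⟩
  have hch := hex.choose_spec
  rw [flow, dif_pos hex]
  have h1 : IsIntegralOn f θ (Icc 0 t) hex.choose := by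
    rw [← uIcc_of_le ht.1]
    exact hch.2
  exact IsIntegralOn.eqOn hf ht.1 (IsIntegralOn.mono hx.2 (Icc_subset_Icc_right ht.2)) h1
    (hch.1.trans hx.1.symm) ⟨ht.1, le_rfl⟩

theorem isSolutionOn_flow [T2Space M]
    (hf : ContMDiff ((𝓡 p).prod (𝓘(ℝ, ℝ).prod (𝓡 n))) (𝓡 n).tangent 1
      (fun q : P × ℝ × M => (⟨q.2.2, f q.1 q.2.1 q.2.2⟩ : TangentBundle (𝓡 n) M)))
    {θ : P} {T : ℝ} (hT : 0 ≤ T) {x₀ : M}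
    (hex : ∃ x : ℝ → M, IsSolutionOn f θ x₀ (Icc 0 T) x) :
    IsSolutionOn f θ x₀ (Icc 0 T) (fun t => flow f θ t x₀) := by
  obtain ⟨x, hx⟩ := hex
  have heq : ∀ t ∈ Icc 0 T, flow f θ t x₀ = x t := fun t ht => flow_eq hf hx ht
  refine ⟨(heq 0 ⟨le_rfl, hT⟩).trans hx.1, fun t ht => ?_⟩
  have key : ∀ m, m = x t → HasMFDerivWithinAt 𝓘(ℝ, ℝ) (𝓡 n) x (Icc 0 T) t
      (ContinuousLinearMap.toSpanSingleton ℝ (show EuclideanSpace ℝ (Fin n) from f θ t m)) := by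
    rintro _ rfl
    exact hx.2 t ht
  exact HasMFDerivWithinAt.congr_mono (key _ (heq t ht)) heq (heq t ht) subset_rfl

end Curves

/-! ### Existence, uniqueness and chart independence of the adjoint state. -/

section Adjoint

set_option linter.unusedSectionVars false

variable {n p : ℕ} {M : Type*} [TopologicalSpace M] [ChartedSpace (EuclideanSpace ℝ (Fin n)) M]
  {P : Type*} [TopologicalSpace P] [ChartedSpace (EuclideanSpace ℝ (Fin p)) P]
  {φ : OpenPartialHomeomorph P (EuclideanSpace ℝ (Fin p))}
  {e e' : OpenPartialHomeomorph M (EuclideanSpace ℝ (Fin n))}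
  {f : P → ℝ → (x : M) → TangentSpace (𝓡 n) x} {r : M → P → ℝ → ℝ}
  [IsManifold (𝓡 n) ∞ M] [IsManifold (𝓡 p) ∞ P]

/-- The adjoint equation at time `t` in the chart `e`. -/
def AdjointEqAt (φ : OpenPartialHomeomorph P (EuclideanSpace ℝ (Fin p)))
    (e : OpenPartialHomeomorph M (EuclideanSpace ℝ (Fin n)))
    (f : P → ℝ → (x : M) → TangentSpace (𝓡 n) x) (r : M → P → ℝ → ℝ)
    (w₀ : EuclideanSpace ℝ (Fin p)) (x : ℝ → M) (l : ℝ → EuclideanSpace ℝ (Fin n) →L[ℝ] ℝ)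
    (S : Set ℝ) (t : ℝ) : Prop :=
  HasDerivWithinAt (fun s => coRep e (x s) (l s))
    (-(coRep e (x t) (l t)).comp (derivState (localField φ e f) (w₀, t, e (x t)))
      - derivState (localCost φ e r) (w₀, t, e (x t))) S t

/-- The adjoint equation along `x` on `S` in all charts. -/
def AdjointEqOn (φ : OpenPartialHomeomorph P (EuclideanSpace ℝ (Fin p)))
    (f : P → ℝ → (x : M) → TangentSpace (𝓡 n) x) (r : M → P → ℝ → ℝ)
    (w₀ : EuclideanSpace ℝ (Fin p)) (x : ℝ → M) (l : ℝ → EuclideanSpace ℝ (Fin n) →L[ℝ] ℝ)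
    (S : Set ℝ) : Prop :=
  ∀ e ∈ IsManifold.maximalAtlas (𝓡 n) ∞ M, ∀ t ∈ S, x t ∈ e.source →
    AdjointEqAt φ e f r w₀ x l S t

theorem AdjointEqOn.mono {w₀ : EuclideanSpace ℝ (Fin p)} {x : ℝ → M}
    {l : ℝ → EuclideanSpace ℝ (Fin n) →L[ℝ] ℝ} {S S' : Set ℝ} (h : AdjointEqOn φ f r w₀ x l S)
    (hS : S' ⊆ S) : AdjointEqOn φ f r w₀ x l S' :=
  fun e he t ht hx => HasDerivWithinAt.mono (h e he t (hS ht) hx) hS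

theorem differentiableAt_state {V : Type*} [NormedAddCommGroup V] [NormedSpace ℝ V]
    {g : EuclideanSpace ℝ (Fin p) × ℝ × EuclideanSpace ℝ (Fin n) → V}
    (hg : ContDiffOn ℝ 1 g (chartDomain φ e)) {w : EuclideanSpace ℝ (Fin p)} {t : ℝ}
    {u : EuclideanSpace ℝ (Fin n)} (hw : w ∈ φ.target) (hu : u ∈ e.target) :
    DifferentiableAt ℝ (fun u => g (w, t, u)) u :=
  ((hg.differentiableOn one_ne_zero).differentiableAt
    (isOpen_chartDomain.mem_nhds ⟨hw, mem_univ _, hu⟩)).comp u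
    ((differentiableAt_const w).prodMk ((differentiableAt_const t).prodMk differentiableAt_id))

/-- The adjoint equation does not depend on the chart. -/
theorem AdjointEqAt.transition (hφ : φ ∈ IsManifold.maximalAtlas (𝓡 p) ∞ P)
    (he : e ∈ IsManifold.maximalAtlas (𝓡 n) ∞ M) (he' : e' ∈ IsManifold.maximalAtlas (𝓡 n) ∞ M)
    (hf : ContMDiff ((𝓡 p).prod (𝓘(ℝ, ℝ).prod (𝓡 n))) (𝓡 n).tangent 1
      (fun q : P × ℝ × M => (⟨q.2.2, f q.1 q.2.1 q.2.2⟩ : TangentBundle (𝓡 n) M)))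
    (hr : ContMDiff ((𝓡 n).prod ((𝓡 p).prod 𝓘(ℝ, ℝ))) 𝓘(ℝ, ℝ) 1
      (fun q : M × P × ℝ => r q.1 q.2.1 q.2.2))
    {w₀ : EuclideanSpace ℝ (Fin p)} (hw₀ : w₀ ∈ φ.target) {S : Set ℝ} {x : ℝ → M}
    (hx : IsIntegralOn f (φ.symm w₀) S x) {l : ℝ → EuclideanSpace ℝ (Fin n) →L[ℝ] ℝ} {t : ℝ}
    (ht : t ∈ S) (hxe : x t ∈ e.source) (hxe' : x t ∈ e'.source)
    (h : AdjointEqAt φ e f r w₀ x l S t) : AdjointEqAt φ e' f r w₀ x l S t := by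
  set u₀ := e' (x t) with hu₀
  have hτu : (e ∘ e'.symm) u₀ = e (x t) := by simp [hu₀, e'.left_inv hxe']
  have hG := contDiffOn_localField hφ he hf
  have hG' := contDiffOn_localField hφ he' hf
  have hρ := contDiffOn_localCost hφ he hr
  have hnear : ∀ᶠ s in 𝓝[S] t, x s ∈ e.source ∧ x s ∈ e'.source :=
    (hx.continuousOn t ht).eventually (inter_mem (e.open_source.mem_nhds hxe)
      (e'.open_source.mem_nhds hxe'))
  have key := adjoint_equation_transition (τ := e ∘ e'.symm) (u₀ := u₀)
    (g := fun u => localField φ e f (w₀, t, u)) (g' := fun u => localField φ e' f (w₀, t, u))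
    (ρ := fun u => localCost φ e r (w₀, t, u)) (ρ' := fun u => localCost φ e' r (w₀, t, u))
    (S := S) (t := t) (u := fun s => e' (x s)) (Λ := fun s => coRep e (x s) (l s))
    ((contDiffAt_transition he he' hxe hxe').of_le ENat.LEInfty.out)
    (by rw [hτu]; exact differentiableAt_state hG hw₀ (e.map_source hxe))
    (differentiableAt_state hG' hw₀ (e'.map_source hxe'))
    (by rw [hτu]; exact differentiableAt_state hρ hw₀ (e.map_source hxe))
    (by
      filter_upwards [transition_source_mem_nhds hxe hxe'] with u hu
      exact localField_transition he he' hu.1 hu.2 w₀ t)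
    (by
      filter_upwards [transition_source_mem_nhds hxe hxe'] with u hu
      simp [localCost, e.left_inv hu.2])
    rfl (hx.hasDerivWithinAt_chart he' ht hxe') (by rw [hτu]; exact h)
  rw [← coRep_transition he he' hxe hxe'] at key
  exact key.congr_of_eventuallyEq
    (hnear.mono fun s hs => coRep_transition he he' hs.1 hs.2 (l s))
    (coRep_transition he he' hxe hxe' (l t))

/-- Local bounds for the coefficients of the adjoint equation. -/
theorem exists_adjoint_coefficient_bound (hφ : φ ∈ IsManifold.maximalAtlas (𝓡 p) ∞ P)
    (he : e ∈ IsManifold.maximalAtlas (𝓡 n) ∞ M)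
    (hf : ContMDiff ((𝓡 p).prod (𝓘(ℝ, ℝ).prod (𝓡 n))) (𝓡 n).tangent 1
      (fun q : P × ℝ × M => (⟨q.2.2, f q.1 q.2.1 q.2.2⟩ : TangentBundle (𝓡 n) M)))
    (hr : ContMDiff ((𝓡 n).prod ((𝓡 p).prod 𝓘(ℝ, ℝ))) 𝓘(ℝ, ℝ) 1
      (fun q : M × P × ℝ => r q.1 q.2.1 q.2.2))
    {w₀ : EuclideanSpace ℝ (Fin p)} (hw₀ : w₀ ∈ φ.target) {T : ℝ} {x : ℝ → M}
    (hx : ContinuousOn x (Icc 0 T)) {t₀ : ℝ} (ht₀ : t₀ ∈ Icc 0 T) (hxt₀ : x t₀ ∈ e.source) :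
    ∃ C ≥ 0, ∃ D ≥ 0, ∃ ε > 0, (2 * C + D) * (2 * ε) ≤ 1 ∧ ∀ a b, 0 ≤ a → a ≤ b → b ≤ T →
      t₀ - ε < a → b < t₀ + ε →
      (∀ t ∈ Icc a b, x t ∈ e.source ∧ ‖derivState (localField φ e f) (w₀, t, e (x t))‖ ≤ C ∧
        ‖derivState (localCost φ e r) (w₀, t, e (x t))‖ ≤ D) ∧
      ContinuousOn (fun t => derivState (localField φ e f) (w₀, t, e (x t))) (Icc a b) ∧
      ContinuousOn (fun t => derivState (localCost φ e r) (w₀, t, e (x t))) (Icc a b) := by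
  have hG := continuousOn_derivState (contDiffOn_localField hφ he hf) isOpen_chartDomain
  have hρ := continuousOn_derivState (contDiffOn_localCost hφ he hr) isOpen_chartDomain
  have hz : ∀ t ∈ Icc 0 T, x t ∈ e.source →
      ContinuousWithinAt (fun t => (w₀, t, e (x t))) (Icc 0 T) t := fun t ht hxt =>
    continuousWithinAt_const.prodMk (continuousWithinAt_id.prodMk
      ((e.continuousAt hxt).comp_continuousWithinAt (hx t ht)))
  have hmem : ∀ t, x t ∈ e.source → chartDomain φ e ∈ 𝓝 (w₀, t, e (x t)) := fun t hxt =>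
    isOpen_chartDomain.mem_nhds ⟨hw₀, mem_univ _, e.map_source hxt⟩
  have hA : ∀ t ∈ Icc 0 T, x t ∈ e.source → ContinuousWithinAt
      (fun t => derivState (localField φ e f) (w₀, t, e (x t))) (Icc 0 T) t := fun t ht hxt =>
    ContinuousAt.comp_continuousWithinAt (f := fun t => (w₀, t, e (x t)))
      (hG.continuousAt (hmem t hxt)) (hz t ht hxt)
  have hβ : ∀ t ∈ Icc 0 T, x t ∈ e.source → ContinuousWithinAt
      (fun t => derivState (localCost φ e r) (w₀, t, e (x t))) (Icc 0 T) t := fun t ht hxt =>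
    ContinuousAt.comp_continuousWithinAt (f := fun t => (w₀, t, e (x t)))
      (hρ.continuousAt (hmem t hxt)) (hz t ht hxt)
  set C := ‖derivState (localField φ e f) (w₀, t₀, e (x t₀))‖ + 1 with hC
  set D := ‖derivState (localCost φ e r) (w₀, t₀, e (x t₀))‖ + 1 with hD
  have hC0 : 0 < C := by positivity
  have hD0 : 0 < D := by positivity
  have h1 := (hA t₀ ht₀ hxt₀).norm.eventually_lt continuousWithinAt_const (lt_add_one _)
  have h2 := (hβ t₀ ht₀ hxt₀).norm.eventually_lt continuousWithinAt_const (lt_add_one _)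
  have h3 := (hx t₀ ht₀).eventually (e.open_source.mem_nhds hxt₀)
  obtain ⟨ε', hε', h⟩ :=
    Metric.eventually_nhds_iff.1 (eventually_nhdsWithin_iff.1 (h1.and (h2.and h3)))
  -- The second bound makes every interval of length below `2 * ε` short enough for
  -- `exists_linear_ode_solution`.
  set ε := min ε' (1 / (2 * (2 * C + D))) with hε
  refine ⟨C, hC0.le, D, hD0.le, ε, lt_min hε' (by positivity), ?_, ?_⟩
  · calc (2 * C + D) * (2 * ε) ≤ (2 * C + D) * (2 * (1 / (2 * (2 * C + D)))) := by
          gcongr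
          exact min_le_right _ _
      _ = 1 := by field_simp
  · intro a b ha hab hb haε hbε
    have hT : Icc a b ⊆ Icc 0 T := Icc_subset_Icc ha hb
    have hall : ∀ t ∈ Icc a b, _ := fun t ht => h (y := t) (by
      rw [Real.dist_eq]
      refine lt_of_lt_of_le (abs_lt.2 ⟨?_, ?_⟩) (min_le_left _ _ : ε ≤ ε')
      · linarith [ht.1]
      · linarith [ht.2]) (hT ht)
    exact ⟨fun t ht => ⟨(hall t ht).2.2, (hall t ht).1.le, (hall t ht).2.1.le⟩,
      fun t ht => (hA t (hT ht) (hall t ht).2.2).mono hT,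
      fun t ht => (hβ t (hT ht) (hall t ht).2.2).mono hT⟩

section

variable {E : Type*} [NormedAddCommGroup E] [NormedSpace ℝ E]

/-- The linear operator of the adjoint equation. -/
def adjointOp (B : E →L[ℝ] E) : (E →L[ℝ] ℝ) →L[ℝ] (E →L[ℝ] ℝ) :=
  (ContinuousLinearMap.compL ℝ E E ℝ).flip (-B)

theorem adjointOp_apply (B : E →L[ℝ] E) (Λ : E →L[ℝ] ℝ) : adjointOp B Λ = -Λ.comp B :=
  ContinuousLinearMap.comp_neg Λ B

theorem norm_adjointOp_le (B : E →L[ℝ] E) : ‖adjointOp B‖ ≤ ‖B‖ :=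
  ContinuousLinearMap.opNorm_le_bound _ (norm_nonneg _) fun Λ => by
    rw [adjointOp_apply, norm_neg, mul_comm]
    exact Λ.opNorm_comp_le B

theorem continuous_adjointOp : Continuous (adjointOp (E := E)) :=
  (ContinuousLinearMap.continuous _).comp continuous_neg

end

/-- On a short interval the equation is a linear ODE in one chart, solved backward from the final
value; `AdjointEqAt.transition` then gives it in every chart, and the pieces are glued. -/
theorem exists_adjointEqOn (hφ : φ ∈ IsManifold.maximalAtlas (𝓡 p) ∞ P)
    (hf : ContMDiff ((𝓡 p).prod (𝓘(ℝ, ℝ).prod (𝓡 n))) (𝓡 n).tangent 1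
      (fun q : P × ℝ × M => (⟨q.2.2, f q.1 q.2.1 q.2.2⟩ : TangentBundle (𝓡 n) M)))
    (hr : ContMDiff ((𝓡 n).prod ((𝓡 p).prod 𝓘(ℝ, ℝ))) 𝓘(ℝ, ℝ) 1
      (fun q : M × P × ℝ => r q.1 q.2.1 q.2.2))
    {w₀ : EuclideanSpace ℝ (Fin p)} (hw₀ : w₀ ∈ φ.target) {T : ℝ} (hT : 0 ≤ T) {x : ℝ → M}
    (hx : IsIntegralOn f (φ.symm w₀) (Icc 0 T) x) (v : EuclideanSpace ℝ (Fin n) →L[ℝ] ℝ) :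
    ∃ l, l T = v ∧ AdjointEqOn φ f r w₀ x l (Icc 0 T) := by
  -- Quantifying over all final values makes the relation transitive: the right piece is solved
  -- first and its value at the junction becomes the final value of the left one.
  refine interval_induction (R := fun a b => ∀ v : EuclideanSpace ℝ (Fin n) →L[ℝ] ℝ,
    ∃ l, l b = v ∧ AdjointEqOn φ f r w₀ x l (Icc a b)) hT ?_ ?_ v
  · intro a b c _ hab hbc _ h1 h2 v
    obtain ⟨l₂, hl₂, hA₂⟩ := h2 v
    obtain ⟨l₁, hl₁, hA₁⟩ := h1 (l₂ b)
    set l : ℝ → EuclideanSpace ℝ (Fin n) →L[ℝ] ℝ := fun s => if s ≤ b then l₁ s else l₂ s with hl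
    have e1 : ∀ s ∈ Icc a b, l s = l₁ s := fun s hs => if_pos hs.2
    have e2 : ∀ s ∈ Icc b c, l s = l₂ s := fun s hs => by
      rcases hs.1.eq_or_lt with rfl | h
      · simp [hl, hl₁]
      · simp [hl, not_le.2 h]
    refine ⟨l, (e2 c ⟨hbc, le_rfl⟩).trans hl₂, fun e he t ht hxt => ?_⟩
    have d1 : HasDerivWithinAt (fun s => coRep e (x s) (l s))
        (-(coRep e (x t) (l t)).comp (derivState (localField φ e f) (w₀, t, e (x t)))
          - derivState (localCost φ e r) (w₀, t, e (x t))) (Icc a b) t := by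
      -- Away from a closed piece, a derivative within it is vacuous; so both one-sided statements
      -- hold for every `t` and can be united, also at the junction.
      by_cases htb : t ∈ Icc a b
      · rw [e1 t htb]
        exact HasDerivWithinAt.congr (hA₁ e he t htb hxt) (fun s hs => by rw [e1 s hs])
          (by rw [e1 t htb])
      · exact (HasFDerivWithinAt.of_notMem_closure (by rwa [isClosed_Icc.closure_eq]))
    have d2 : HasDerivWithinAt (fun s => coRep e (x s) (l s))
        (-(coRep e (x t) (l t)).comp (derivState (localField φ e f) (w₀, t, e (x t)))
          - derivState (localCost φ e r) (w₀, t, e (x t))) (Icc b c) t := by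
      by_cases htb : t ∈ Icc b c
      · rw [e2 t htb]
        exact HasDerivWithinAt.congr (hA₂ e he t htb hxt) (fun s hs => by rw [e2 s hs])
          (by rw [e2 t htb])
      · exact (HasFDerivWithinAt.of_notMem_closure (by rwa [isClosed_Icc.closure_eq]))
    have d := d1.union d2
    rwa [Icc_union_Icc_eq_Icc hab hbc] at d
  · intro t₀ ht₀
    set e := chartAt (EuclideanSpace ℝ (Fin n)) (x t₀)
    have he : e ∈ IsManifold.maximalAtlas (𝓡 n) ∞ M := chartAt_mem_maximalAtlas _
    obtain ⟨C, hC, D, hD, ε, hε, hshort, h⟩ := exists_adjoint_coefficient_bound hφ he hf hr hw₀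
      hx.continuousOn ht₀ (mem_chart_source _ _)
    refine ⟨ε, hε, fun a b ha hab hb haε hbε v => ?_⟩
    obtain ⟨hbd, hAc, hβc⟩ := h a b ha hab hb haε hbε
    obtain ⟨Λ, hΛb, hΛ⟩ := exists_linear_ode_solution
      (A := fun t => adjointOp (derivState (localField φ e f) (w₀, t, e (x t))))
      (β := fun t => -derivState (localCost φ e r) (w₀, t, e (x t))) hab
      (continuous_adjointOp.comp_continuousOn hAc) hβc.neg
      (fun t ht => (norm_adjointOp_le _).trans (hbd t ht).2.1)
      (fun t ht => by rw [norm_neg]; exact (hbd t ht).2.2)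
      ((mul_le_mul_of_nonneg_left (by linarith) (by positivity)).trans hshort)
      (coRep e (x b) v)
    have hco : ∀ s ∈ Icc a b, coRep e (x s) ((Λ s).comp (chartDeriv e (x s))) = Λ s :=
      fun s hs => coRep_comp_self he (hbd s hs).1 _
    -- The covector is the pullback of the coordinate solution under the differential of the chart.
    refine ⟨fun s => (Λ s).comp (chartDeriv e (x s)), ?_, fun e' he' t ht hxt => ?_⟩
    · simp only [hΛb]
      exact coRep_comp_chartDeriv he (hbd b ⟨hab, le_rfl⟩).1 v
    · refine AdjointEqAt.transition hφ he he' hf hr hw₀ (hx.mono (Icc_subset_Icc ha hb)) ht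
        (hbd t ht).1 hxt ?_
      unfold AdjointEqAt
      rw [hco t ht, sub_eq_add_neg, ← adjointOp_apply]
      exact (hΛ t ht).congr hco (hco t ht)

/-- Agreement propagates backward in time: locally by uniqueness for linear ODEs in a chart,
globally by concatenation, with the right piece used before the left. -/
theorem AdjointEqOn.eqOn (hφ : φ ∈ IsManifold.maximalAtlas (𝓡 p) ∞ P)
    (hf : ContMDiff ((𝓡 p).prod (𝓘(ℝ, ℝ).prod (𝓡 n))) (𝓡 n).tangent 1
      (fun q : P × ℝ × M => (⟨q.2.2, f q.1 q.2.1 q.2.2⟩ : TangentBundle (𝓡 n) M)))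
    (hr : ContMDiff ((𝓡 n).prod ((𝓡 p).prod 𝓘(ℝ, ℝ))) 𝓘(ℝ, ℝ) 1
      (fun q : M × P × ℝ => r q.1 q.2.1 q.2.2))
    {w₀ : EuclideanSpace ℝ (Fin p)} (hw₀ : w₀ ∈ φ.target) {T : ℝ} (hT : 0 ≤ T) {x : ℝ → M}
    (hx : ContinuousOn x (Icc 0 T)) {l l' : ℝ → EuclideanSpace ℝ (Fin n) →L[ℝ] ℝ}
    (hl : AdjointEqOn φ f r w₀ x l (Icc 0 T)) (hl' : AdjointEqOn φ f r w₀ x l' (Icc 0 T))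
    (hlT : l' T = l T) : EqOn l' l (Icc 0 T) := by
  refine interval_induction (R := fun a b => l' b = l b → EqOn l' l (Icc a b)) hT ?_ ?_ hlT
  · intro a b c _ hab hbc _ h1 h2 hc
    rw [← Icc_union_Icc_eq_Icc hab hbc]
    exact (h1 (h2 hc ⟨le_rfl, hbc⟩)).union (h2 hc)
  · intro t₀ ht₀
    set e := chartAt (EuclideanSpace ℝ (Fin n)) (x t₀)
    have he : e ∈ IsManifold.maximalAtlas (𝓡 n) ∞ M := chartAt_mem_maximalAtlas _
    obtain ⟨C, hC, D, hD, ε, hε, hshort, h⟩ := exists_adjoint_coefficient_bound hφ he hf hr hw₀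
      hx ht₀ (mem_chart_source _ _)
    refine ⟨ε, hε, fun a b ha hab hb haε hbε hlb t ht => ?_⟩
    obtain ⟨hbd, hAc, hβc⟩ := h a b ha hab hb haε hbε
    have hode : ∀ {l : ℝ → EuclideanSpace ℝ (Fin n) →L[ℝ] ℝ},
        AdjointEqOn φ f r w₀ x l (Icc 0 T) → ∀ t ∈ Icc a b,
        HasDerivWithinAt (fun s => coRep e (x s) (l s))
          (adjointOp (derivState (localField φ e f) (w₀, t, e (x t))) (coRep e (x t) (l t))
            + -derivState (localCost φ e r) (w₀, t, e (x t))) (Icc a b) t := fun hl t ht => by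
      rw [adjointOp_apply, ← sub_eq_add_neg]
      exact hl.mono (Icc_subset_Icc ha hb) e he t ht (hbd t ht).1
    have heq := linear_ode_solution_unique
      (A := fun t => adjointOp (derivState (localField φ e f) (w₀, t, e (x t))))
      (β := fun t => -derivState (localCost φ e r) (w₀, t, e (x t)))
      (fun t ht => (norm_adjointOp_le _).trans (hbd t ht).2.1) (hode hl') (hode hl)
      (by rw [hlb]) ht
    have := congrArg (fun L => L.comp (chartDeriv e (x t))) heq
    simpa only [coRep_comp_chartDeriv he (hbd t ht).1] using this

end Adjoint

/-! ### Displacements across charts and the integrated pairing identity. -/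

section Gradient

set_option linter.unusedSectionVars false

variable {n p : ℕ} {M : Type*} [TopologicalSpace M] [ChartedSpace (EuclideanSpace ℝ (Fin n)) M]
  {P : Type*} [TopologicalSpace P] [ChartedSpace (EuclideanSpace ℝ (Fin p)) P]
  {φ : OpenPartialHomeomorph P (EuclideanSpace ℝ (Fin p))}
  {e e' : OpenPartialHomeomorph M (EuclideanSpace ℝ (Fin n))}
  {f : P → ℝ → (x : M) → TangentSpace (𝓡 n) x} {r : M → P → ℝ → ℝ}

/-- A derivative in the preferred chart is a manifold derivative. -/
theorem hasMFDerivAt_of_chart {k : ℕ} {N : Type*} [TopologicalSpace N]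
    [ChartedSpace (EuclideanSpace ℝ (Fin k)) N] {g : N → ℝ} {q : N}
    {g' : EuclideanSpace ℝ (Fin k) →L[ℝ] ℝ}
    (h : HasFDerivAt (fun u => g ((chartAt (EuclideanSpace ℝ (Fin k)) q).symm u)) g'
      (chartAt (EuclideanSpace ℝ (Fin k)) q q)) :
    HasMFDerivAt (𝓡 k) 𝓘(ℝ, ℝ) g q g' := by
  set c := chartAt (EuclideanSpace ℝ (Fin k)) q
  have hq : q ∈ c.source := mem_chart_source _ q
  refine ⟨?_, ?_⟩
  · have h1 : ContinuousAt (fun y => g (c.symm (c y))) q :=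
      ContinuousAt.comp (f := c) (g := fun u => g (c.symm u)) h.continuousAt (c.continuousAt hq)
    refine h1.congr ?_
    filter_upwards [c.open_source.mem_nhds hq] with y hy
    rw [c.left_inv hy]
  · have : writtenInExtChartAt (𝓡 k) 𝓘(ℝ, ℝ) q g = fun u => g (c.symm u) := by
      ext u
      simp [writtenInExtChartAt, extChartAt, c]
      rfl
    rw [this]
    simpa [extChartAt, c] using! h.hasFDerivWithinAt

variable [IsManifold (𝓡 n) ∞ M]

/-- Displacements of first order in one chart are of first order in every chart, and their pairings
with a covector agree to first order. -/
theorem displacement_transition (he : e ∈ IsManifold.maximalAtlas (𝓡 n) ∞ M)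
    (he' : e' ∈ IsManifold.maximalAtlas (𝓡 n) ∞ M) {W : Type*} [NormedAddCommGroup W] {w₀ : W}
    {y : W → M} {m : M} (hm : m ∈ e.source) (hm' : m ∈ e'.source)
    (hy : ∀ᶠ w in 𝓝 w₀, y w ∈ e.source)
    (hO : (fun w => e (y w) - e m) =O[𝓝 w₀] fun w => w - w₀)
    (l : EuclideanSpace ℝ (Fin n) →L[ℝ] ℝ) :
    (∀ᶠ w in 𝓝 w₀, y w ∈ e'.source) ∧ ((fun w => e' (y w) - e' m) =O[𝓝 w₀] fun w => w - w₀) ∧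
      (fun w => coRep e' m l (e' (y w) - e' m) - coRep e m l (e (y w) - e m)) =o[𝓝 w₀]
        fun w => w - w₀ := by
  have h0 : Tendsto (fun w => w - w₀) (𝓝 w₀) (𝓝 0) := by
    have : Tendsto (fun w => w - w₀) (𝓝 w₀) (𝓝 (w₀ - w₀)) := tendsto_id.sub_const w₀
    rwa [sub_self] at this
  -- No continuity of `y` is assumed; the first-order bound provides it, and with it membership in
  -- the second chart.
  have hlim : Tendsto (fun w => e (y w)) (𝓝 w₀) (𝓝 (e m)) := by
    simpa using (hO.trans_tendsto h0).add_const (e m)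
  have hmem := hlim.eventually (transition_source_mem_nhds hm' hm)
  have hsrc : ∀ᶠ w in 𝓝 w₀, y w ∈ e'.source := by
    filter_upwards [hmem, hy] with w hw hyw
    rw [← e.left_inv hyw]
    exact hw.2
  have hd := ((contDiffAt_transition he' he hm' hm).differentiableAt (by simp)).hasFDerivAt.isLittleO
  have ho : (fun w => e' (y w) - e' m - fderiv ℝ (e' ∘ e.symm) (e m) (e (y w) - e m)) =o[𝓝 w₀]
      fun w => w - w₀ := by
    refine ((hd.comp_tendsto hlim).trans_isBigO hO).congr' ?_ .rfl
    filter_upwards [hy] with w hw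
    simp [e.left_inv hw, e.left_inv hm]
  refine ⟨hsrc, ?_, ?_⟩
  · have h1 := ho.isBigO.add
      ((ContinuousLinearMap.isBigO_comp (fderiv ℝ (e' ∘ e.symm) (e m)) _ _).trans hO)
    simpa using h1
  · refine ((ContinuousLinearMap.isBigO_comp (coRep e' m l) _ _).trans_isLittleO ho).congr_left
      fun w => ?_
    rw [map_sub, coRep_transition he' he hm' hm]
    rfl

variable [IsManifold (𝓡 p) ∞ P]

/-- The function on the left involves no chart of `M`, so its derivative can be computed in
whichever chart is convenient. This identifies the integrand of the coordinate pairing identity with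
an intrinsic one. -/
theorem hasFDerivAt_hamiltonian (hφ : φ ∈ IsManifold.maximalAtlas (𝓡 p) ∞ P)
    (he : e ∈ IsManifold.maximalAtlas (𝓡 n) ∞ M)
    (hf : ContMDiff ((𝓡 p).prod (𝓘(ℝ, ℝ).prod (𝓡 n))) (𝓡 n).tangent 1
      (fun q : P × ℝ × M => (⟨q.2.2, f q.1 q.2.1 q.2.2⟩ : TangentBundle (𝓡 n) M)))
    (hr : ContMDiff ((𝓡 n).prod ((𝓡 p).prod 𝓘(ℝ, ℝ))) 𝓘(ℝ, ℝ) 1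
      (fun q : M × P × ℝ => r q.1 q.2.1 q.2.2))
    {w₀ : EuclideanSpace ℝ (Fin p)} (hw₀ : w₀ ∈ φ.target) {m : M} (hm : m ∈ e.source) (t : ℝ)
    (l : EuclideanSpace ℝ (Fin n) →L[ℝ] ℝ) :
    HasFDerivAt (fun w => l (f (φ.symm w) t m) + r m (φ.symm w) t)
      ((coRep e m l).comp (derivParam (localField φ e f) (w₀, t, e m))
        + derivParam (localCost φ e r) (w₀, t, e m)) w₀ := by
  have hd : ∀ {V : Type} [NormedAddCommGroup V] [NormedSpace ℝ V]
      {g : EuclideanSpace ℝ (Fin p) × ℝ × EuclideanSpace ℝ (Fin n) → V},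
      ContDiffOn ℝ 1 g (chartDomain φ e) →
      HasFDerivAt (fun w => g (w, t, e m)) (derivParam g (w₀, t, e m)) w₀ := fun hg =>
    (((hg.differentiableOn one_ne_zero).differentiableAt (isOpen_chartDomain.mem_nhds
      ⟨hw₀, mem_univ _, e.map_source hm⟩)).comp w₀
      (differentiableAt_id.prodMk (differentiableAt_const (t, e m)))).hasFDerivAt
  have h1 := ((coRep e m l).hasFDerivAt.comp w₀ (hd (contDiffOn_localField hφ he hf))).add
    (hd (contDiffOn_localCost hφ he hr))
  refine h1.congr_of_eventuallyEq (.of_forall fun w => ?_)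
  have key : ∀ m', m' = m → l (f (φ.symm w) t m)
      = coRep e m l (chartDeriv e m' (f (φ.symm w) t m')) := by
    rintro _ rfl
    exact (DFunLike.congr_fun (coRep_comp_chartDeriv he hm l) _).symm
  exact congrArg₂ (· + ·) (key _ (e.left_inv hm)) (by simp only [localCost, e.left_inv hm])

/-- The derivative of the Hamiltonian in the parameter. -/
def hamiltonianDeriv (φ : OpenPartialHomeomorph P (EuclideanSpace ℝ (Fin p)))
    (f : P → ℝ → (x : M) → TangentSpace (𝓡 n) x) (r : M → P → ℝ → ℝ)
    (w₀ : EuclideanSpace ℝ (Fin p)) (x : ℝ → M) (l : ℝ → EuclideanSpace ℝ (Fin n) →L[ℝ] ℝ)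
    (t : ℝ) : EuclideanSpace ℝ (Fin p) →L[ℝ] ℝ :=
  fderiv ℝ (fun w => l t (f (φ.symm w) t (x t)) + r (x t) (φ.symm w) t) w₀

/-- As an element of the dual of the model space, `l t` may jump when the preferred chart at `x t`
changes. Near each time one fixed chart is therefore used, in which the representation of `l` is
differentiable, hence continuous. -/
theorem continuousOn_hamiltonianDeriv (hφ : φ ∈ IsManifold.maximalAtlas (𝓡 p) ∞ P)
    (hf : ContMDiff ((𝓡 p).prod (𝓘(ℝ, ℝ).prod (𝓡 n))) (𝓡 n).tangent 1
      (fun q : P × ℝ × M => (⟨q.2.2, f q.1 q.2.1 q.2.2⟩ : TangentBundle (𝓡 n) M)))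
    (hr : ContMDiff ((𝓡 n).prod ((𝓡 p).prod 𝓘(ℝ, ℝ))) 𝓘(ℝ, ℝ) 1
      (fun q : M × P × ℝ => r q.1 q.2.1 q.2.2))
    {w₀ : EuclideanSpace ℝ (Fin p)} (hw₀ : w₀ ∈ φ.target) {S : Set ℝ} {x : ℝ → M}
    (hx : ContinuousOn x S) {l : ℝ → EuclideanSpace ℝ (Fin n) →L[ℝ] ℝ}
    (hl : AdjointEqOn φ f r w₀ x l S) : ContinuousOn (hamiltonianDeriv φ f r w₀ x l) S := by
  intro t ht
  set e := chartAt (EuclideanSpace ℝ (Fin n)) (x t)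
  have he : e ∈ IsManifold.maximalAtlas (𝓡 n) ∞ M := chartAt_mem_maximalAtlas _
  have hxt : x t ∈ e.source := mem_chart_source _ _
  have hz : ContinuousWithinAt (fun t => (w₀, t, e (x t))) S t :=
    continuousWithinAt_const.prodMk (continuousWithinAt_id.prodMk
      ((e.continuousAt hxt).comp_continuousWithinAt (hx t ht)))
  have hmem : chartDomain φ e ∈ 𝓝 (w₀, t, e (x t)) :=
    isOpen_chartDomain.mem_nhds ⟨hw₀, mem_univ _, e.map_source hxt⟩
  have h1 : ContinuousWithinAt
      (fun t => derivParam (localField φ e f) (w₀, t, e (x t))) S t :=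
    ContinuousAt.comp_continuousWithinAt (f := fun t => (w₀, t, e (x t)))
      ((continuousOn_derivParam (contDiffOn_localField hφ he hf)
        isOpen_chartDomain).continuousAt hmem) hz
  have h2 : ContinuousWithinAt
      (fun t => derivParam (localCost φ e r) (w₀, t, e (x t))) S t :=
    ContinuousAt.comp_continuousWithinAt (f := fun t => (w₀, t, e (x t)))
      ((continuousOn_derivParam (contDiffOn_localCost hφ he hr)
        isOpen_chartDomain).continuousAt hmem) hz
  have h3 := ((HasDerivWithinAt.continuousWithinAt (hl e he t ht hxt)).clm_comp h1).add h2
  refine h3.congr_of_eventuallyEq ?_ (hasFDerivAt_hamiltonian hφ he hf hr hw₀ hxt t (l t)).fderiv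
  filter_upwards [(hx t ht).eventually (e.open_source.mem_nhds hxt)] with s hs
  exact (hasFDerivAt_hamiltonian hφ he hf hr hw₀ hs s (l s)).fderiv

/-- The displacement of a family of curves in the preferred chart. -/
def displacement (Y : EuclideanSpace ℝ (Fin p) → ℝ → M) (w₀ : EuclideanSpace ℝ (Fin p)) (t : ℝ)
    (w : EuclideanSpace ℝ (Fin p)) : EuclideanSpace ℝ (Fin n) :=
  chartAt (EuclideanSpace ℝ (Fin n)) (Y w₀ t) (Y w t)
    - chartAt (EuclideanSpace ℝ (Fin n)) (Y w₀ t) (Y w₀ t)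

/-- The displacement of a family of curves is of first order. -/
def DisplacementIsBigO (Y : EuclideanSpace ℝ (Fin p) → ℝ → M) (w₀ : EuclideanSpace ℝ (Fin p))
    (t : ℝ) : Prop :=
  (∀ᶠ w in 𝓝 w₀, Y w t ∈ (chartAt (EuclideanSpace ℝ (Fin n)) (Y w₀ t)).source) ∧
    (displacement (n := n) Y w₀ t) =O[𝓝 w₀] fun w => w - w₀

theorem continuousOn_runningCost
    (hr : ContMDiff ((𝓡 n).prod ((𝓡 p).prod 𝓘(ℝ, ℝ))) 𝓘(ℝ, ℝ) 1
      (fun q : M × P × ℝ => r q.1 q.2.1 q.2.2)) {S : Set ℝ} {x : ℝ → M} (hx : ContinuousOn x S)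
    (θ : P) : ContinuousOn (fun t => r (x t) θ t) S :=
  hr.continuous.comp_continuousOn (hx.prodMk (continuousOn_const.prodMk continuousOn_id))

/-- The local form of the gradient formula. -/
theorem gradient_local [T2Space M] (hφ : φ ∈ IsManifold.maximalAtlas (𝓡 p) ∞ P)
    (hf : ContMDiff ((𝓡 p).prod (𝓘(ℝ, ℝ).prod (𝓡 n))) (𝓡 n).tangent 1
      (fun q : P × ℝ × M => (⟨q.2.2, f q.1 q.2.1 q.2.2⟩ : TangentBundle (𝓡 n) M)))
    (hr : ContMDiff ((𝓡 n).prod ((𝓡 p).prod 𝓘(ℝ, ℝ))) 𝓘(ℝ, ℝ) 1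
      (fun q : M × P × ℝ => r q.1 q.2.1 q.2.2))
    {w₀ : EuclideanSpace ℝ (Fin p)} (hw₀ : w₀ ∈ φ.target) {T : ℝ}
    {Y : EuclideanSpace ℝ (Fin p) → ℝ → M}
    (hY : ∀ w ∈ φ.target, IsIntegralOn f (φ.symm w) (Icc 0 T) (Y w))
    {l : ℝ → EuclideanSpace ℝ (Fin n) →L[ℝ] ℝ}
    (hl : AdjointEqOn φ f r w₀ (Y w₀) l (Icc 0 T)) {t₀ : ℝ} (ht₀ : t₀ ∈ Icc 0 T) :
    ∃ ε > 0, ∀ a b, 0 ≤ a → a ≤ b → b ≤ T → t₀ - ε < a → b < t₀ + ε →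
      DisplacementIsBigO (n := n) Y w₀ a → DisplacementIsBigO (n := n) Y w₀ b ∧
        (fun w => l b (displacement Y w₀ b w) - l a (displacement Y w₀ a w)
          + (∫ t in a..b, (r (Y w t) (φ.symm w) t - r (Y w₀ t) (φ.symm w₀) t))
          - (∫ t in a..b, hamiltonianDeriv φ f r w₀ (Y w₀) l t) (w - w₀)) =o[𝓝 w₀]
        fun w => w - w₀ := by
  set e := chartAt (EuclideanSpace ℝ (Fin n)) (Y w₀ t₀)
  have he : e ∈ IsManifold.maximalAtlas (𝓡 n) ∞ M := chartAt_mem_maximalAtlas _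
  have hx := hY w₀ hw₀
  obtain ⟨K, hK, ε, hε, δ, hδ, htube⟩ := exists_tube hφ he hf hw₀ hx ht₀ (mem_chart_source _ _)
  refine ⟨ε, hε, fun a b ha hab hb haε hbε hOa => ?_⟩
  obtain ⟨hxs, htube⟩ := htube a b ha hab hb haε hbε
  have hI : Icc a b ⊆ Icc 0 T := Icc_subset_Icc ha hb
  have haI : a ∈ Icc a b := ⟨le_rfl, hab⟩
  have hbI : b ∈ Icc a b := ⟨hab, le_rfl⟩
  have h0 : Tendsto (fun w => w - w₀) (𝓝 w₀) (𝓝 0) := by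
    have : Tendsto (fun w => w - w₀) (𝓝 w₀) (𝓝 (w₀ - w₀)) := tendsto_id.sub_const w₀
    rwa [sub_self] at this
  -- The hypothesis at `a` refers to the preferred chart at `Y w₀ a`; it is moved to the working
  -- chart `e`, and the conclusion at `b` is moved back below.
  obtain ⟨hsa, hOa', hpa⟩ := displacement_transition (chartAt_mem_maximalAtlas (Y w₀ a)) he
    (mem_chart_source _ _) (hxs a haI) hOa.1 hOa.2 (l a)
  obtain ⟨c, hc, hca⟩ := hOa'.exists_pos
  have hev : ∀ᶠ w in 𝓝 w₀, w ∈ φ.target ∧ ∀ t ∈ Icc a b, Y w t ∈ e.source ∧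
      ‖e (Y w t) - e (Y w₀ t)‖ ≤ K * (c + 1) * ‖w - w₀‖ := by
    have h1 : ∀ᶠ w in 𝓝 w₀, ‖w - w₀‖ < δ := by
      simpa using h0.norm.eventually_lt tendsto_const_nhds (by simpa using hδ)
    have h2 : ∀ᶠ w in 𝓝 w₀, ‖e (Y w a) - e (Y w₀ a)‖ < δ :=
      (hOa'.trans_tendsto h0).norm.eventually_lt tendsto_const_nhds (by simpa using hδ)
    filter_upwards [h1, h2, hsa, hca.bound] with w h1 h2 h3 h4
    obtain ⟨hwt, h⟩ := htube w h1
    refine ⟨hwt, fun t ht => ?_⟩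
    obtain ⟨h5, h6⟩ := h (Y w) ((hY w hwt).mono hI) h3 h2 t ht
    refine ⟨h5, h6.trans ?_⟩
    rw [mul_assoc, add_mul, one_mul]
    gcongr
  have hOb : (fun w => e (Y w b) - e (Y w₀ b)) =O[𝓝 w₀] fun w => w - w₀ :=
    IsBigO.of_bound (K * (c + 1)) (hev.mono fun w hw => (hw.2 b hbI).2)
  obtain ⟨hsb, hOb', hpb⟩ := displacement_transition he (chartAt_mem_maximalAtlas (Y w₀ b))
    (hxs b hbI) (mem_chart_source _ _) (hev.mono fun w hw => (hw.2 b hbI).1) hOb (l b)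
  refine ⟨⟨hsb, hOb'⟩, ?_⟩
  have hmain := adjoint_pairing_isLittleO isOpen_chartDomain (contDiffOn_localField hφ he hf)
    (contDiffOn_localCost hφ he hr) hab (w₀ := w₀) (X := fun s => e (Y w₀ s))
    (Λ := fun s => coRep e (Y w₀ s) (l s)) (Y := fun w s => e (Y w s)) (K := K * (c + 1))
    (fun t ht => ⟨hw₀, mem_univ _, e.map_source (hxs t ht)⟩)
    (fun t ht => (hx.mono hI).hasDerivWithinAt_chart he ht (hxs t ht))
    (fun t ht => hl.mono hI e he t ht (hxs t ht))
    (hev.mono fun w hw t ht => ⟨hw.1, mem_univ _, e.map_source (hw.2 t ht).1⟩)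
    (hev.mono fun w hw t ht => ((hY w hw.1).mono hI).hasDerivWithinAt_chart he ht (hw.2 t ht).1)
    (hev.mono fun w hw t ht => (hw.2 t ht).2)
  -- The chart-change errors at `b` and `a` replace the two boundary pairings in `e` by those in the
  -- preferred charts.
  refine ((hmain.add hpb).add hpa).congr' ?_ .rfl
  filter_upwards [hev] with w hw
  have i1 : ∫ t in a..b, (localCost φ e r (w, t, e (Y w t)) - localCost φ e r (w₀, t, e (Y w₀ t)))
      = ∫ t in a..b, (r (Y w t) (φ.symm w) t - r (Y w₀ t) (φ.symm w₀) t) :=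
    intervalIntegral.integral_congr fun t ht => by
      rw [uIcc_of_le hab] at ht
      simp only [localCost, e.left_inv (hw.2 t ht).1, e.left_inv (hxs t ht)]
  have i2 : ∫ t in a..b, ((coRep e (Y w₀ t) (l t)).comp
        (derivParam (localField φ e f) (w₀, t, e (Y w₀ t)))
        + derivParam (localCost φ e r) (w₀, t, e (Y w₀ t)))
      = ∫ t in a..b, hamiltonianDeriv φ f r w₀ (Y w₀) l t :=
    intervalIntegral.integral_congr fun t ht => by
      rw [uIcc_of_le hab] at ht
      exact (hasFDerivAt_hamiltonian hφ he hf hr hw₀ (hxs t ht) t (l t)).fderiv.symm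
  rw [i1, i2, coRep_chartAt_self, coRep_chartAt_self]
  simp only [displacement]
  ring

/-- The integrated form of the gradient formula. -/
theorem gradient_integrated [T2Space M] (hφ : φ ∈ IsManifold.maximalAtlas (𝓡 p) ∞ P)
    (hf : ContMDiff ((𝓡 p).prod (𝓘(ℝ, ℝ).prod (𝓡 n))) (𝓡 n).tangent 1
      (fun q : P × ℝ × M => (⟨q.2.2, f q.1 q.2.1 q.2.2⟩ : TangentBundle (𝓡 n) M)))
    (hr : ContMDiff ((𝓡 n).prod ((𝓡 p).prod 𝓘(ℝ, ℝ))) 𝓘(ℝ, ℝ) 1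
      (fun q : M × P × ℝ => r q.1 q.2.1 q.2.2))
    {w₀ : EuclideanSpace ℝ (Fin p)} (hw₀ : w₀ ∈ φ.target) {T : ℝ} (hT : 0 ≤ T) {x₀ : M}
    {Y : EuclideanSpace ℝ (Fin p) → ℝ → M}
    (hY : ∀ w ∈ φ.target, IsIntegralOn f (φ.symm w) (Icc 0 T) (Y w))
    (hY0 : ∀ w ∈ φ.target, Y w 0 = x₀)
    {l : ℝ → EuclideanSpace ℝ (Fin n) →L[ℝ] ℝ}
    (hl : AdjointEqOn φ f r w₀ (Y w₀) l (Icc 0 T)) :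
    DisplacementIsBigO (n := n) Y w₀ T ∧
      (fun w => l T (displacement Y w₀ T w)
        + (∫ t in 0..T, (r (Y w t) (φ.symm w) t - r (Y w₀ t) (φ.symm w₀) t))
        - (∫ t in 0..T, hamiltonianDeriv φ f r w₀ (Y w₀) l t) (w - w₀)) =o[𝓝 w₀]
      fun w => w - w₀ := by
  have hint : ∀ w ∈ φ.target, ∀ a b, 0 ≤ a → a ≤ b → b ≤ T → IntervalIntegrable
      (fun t => r (Y w t) (φ.symm w) t - r (Y w₀ t) (φ.symm w₀) t) volume a b := by
    intro w hw a b ha hab hb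
    refine ContinuousOn.intervalIntegrable (((continuousOn_runningCost hr (hY w hw).continuousOn
      _).sub (continuousOn_runningCost hr (hY w₀ hw₀).continuousOn _)).mono ?_)
    rw [uIcc_of_le hab]
    exact Icc_subset_Icc ha hb
  have hHint : ∀ a b, 0 ≤ a → a ≤ b → b ≤ T → IntervalIntegrable
      (hamiltonianDeriv φ f r w₀ (Y w₀) l) volume a b := by
    intro a b ha hab hb
    refine ContinuousOn.intervalIntegrable ((continuousOn_hamiltonianDeriv hφ hf hr hw₀
      (hY w₀ hw₀).continuousOn hl).mono ?_)
    rw [uIcc_of_le hab]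
    exact Icc_subset_Icc ha hb
  have htarget : ∀ᶠ w in 𝓝 w₀, w ∈ φ.target := φ.open_target.mem_nhds hw₀
  have hd0 : ∀ w ∈ φ.target, displacement (n := n) Y w₀ 0 w = 0 := fun w hw => by
    rw [displacement, hY0 w hw, hY0 w₀ hw₀, sub_self]
  -- Both boundary terms and both integrals are additive over adjacent intervals, and the
  -- first-order bound is handed on from `a` to `b`; this is transitivity.
  have key := interval_induction (R := fun a b => DisplacementIsBigO (n := n) Y w₀ a →
    DisplacementIsBigO (n := n) Y w₀ b ∧
      (fun w => l b (displacement Y w₀ b w) - l a (displacement Y w₀ a w)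
        + (∫ t in a..b, (r (Y w t) (φ.symm w) t - r (Y w₀ t) (φ.symm w₀) t))
        - (∫ t in a..b, hamiltonianDeriv φ f r w₀ (Y w₀) l t) (w - w₀)) =o[𝓝 w₀]
      fun w => w - w₀) hT
    (by
      intro a b c ha hab hbc hc h1 h2 hOa
      obtain ⟨hOb, ho1⟩ := h1 hOa
      obtain ⟨hOc, ho2⟩ := h2 hOb
      refine ⟨hOc, (ho1.add ho2).congr' ?_ .rfl⟩
      filter_upwards [htarget] with w hw
      rw [← intervalIntegral.integral_add_adjacent_intervals
          (hint w hw a b ha hab (hbc.trans hc)) (hint w hw b c (ha.trans hab) hbc hc),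
        ← intervalIntegral.integral_add_adjacent_intervals
          (hHint a b ha hab (hbc.trans hc)) (hHint b c (ha.trans hab) hbc hc), add_apply]
      ring)
    (fun t₀ ht₀ => gradient_local hφ hf hr hw₀ hY hl ht₀)
    -- All solutions start at `x₀`, so the displacement at time 0 vanishes and the induction can
    -- begin.
    ⟨htarget.mono fun w hw => by rw [hY0 w hw, hY0 w₀ hw₀]; exact mem_chart_source _ _,
      (isBigO_zero _ _).congr' (htarget.mono fun w hw => (hd0 w hw).symm) .rfl⟩
  refine ⟨key.1, key.2.congr' ?_ .rfl⟩
  filter_upwards [htarget] with w hw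
  rw [hd0 w hw, map_zero, sub_zero]

end Gradient

/-! ### Components of covectors, and the derivative of the cost. -/

section Components

set_option linter.unusedSectionVars false

theorem _root_.ContinuousLinearMap.eq_sum_single {n : ℕ} (Λ : EuclideanSpace ℝ (Fin n) →L[ℝ] ℝ) :
    Λ = ∑ i, Λ (EuclideanSpace.single i 1) • EuclideanSpace.proj (𝕜 := ℝ) i := by
  ext v
  have h := (EuclideanSpace.basisFun (Fin n) ℝ).sum_repr v
  conv_lhs => rw [← h]
  simp [mul_comm]

/-- A curve of covectors is differentiable if and only if its components are. -/
theorem hasDerivWithinAt_covector_iff {n : ℕ} {Λ : ℝ → EuclideanSpace ℝ (Fin n) →L[ℝ] ℝ}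
    {Λ' : EuclideanSpace ℝ (Fin n) →L[ℝ] ℝ} {S : Set ℝ} {t : ℝ} :
    HasDerivWithinAt Λ Λ' S t ↔ ∀ i, HasDerivWithinAt (fun s => Λ s (EuclideanSpace.single i 1))
      (Λ' (EuclideanSpace.single i 1)) S t := by
  refine ⟨fun h i => ?_, fun h => ?_⟩
  · simpa using h.clm_apply (hasDerivWithinAt_const t S (EuclideanSpace.single i (1 : ℝ)))
  · have h1 := HasDerivWithinAt.fun_sum (u := Finset.univ)
      fun i _ => (h i).smul_const (EuclideanSpace.proj (𝕜 := ℝ) (ι := Fin n) i)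
    rw [← Λ'.eq_sum_single] at h1
    exact h1.congr (fun s _ => (Λ s).eq_sum_single) (Λ t).eq_sum_single

variable {n p : ℕ} {M : Type*} [TopologicalSpace M] [ChartedSpace (EuclideanSpace ℝ (Fin n)) M]
  {P : Type*} [TopologicalSpace P] [ChartedSpace (EuclideanSpace ℝ (Fin p)) P]
  {φ : OpenPartialHomeomorph P (EuclideanSpace ℝ (Fin p))}
  {e : OpenPartialHomeomorph M (EuclideanSpace ℝ (Fin n))}
  {f : P → ℝ → (x : M) → TangentSpace (𝓡 n) x} {r : M → P → ℝ → ℝ}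
  [IsManifold (𝓡 n) ∞ M] [IsManifold (𝓡 p) ∞ P]

/-- The adjoint equation in components. -/
theorem adjointEqOn_iff (hφ : φ ∈ IsManifold.maximalAtlas (𝓡 p) ∞ P)
    (hf : ContMDiff ((𝓡 p).prod (𝓘(ℝ, ℝ).prod (𝓡 n))) (𝓡 n).tangent 1
      (fun q : P × ℝ × M => (⟨q.2.2, f q.1 q.2.1 q.2.2⟩ : TangentBundle (𝓡 n) M)))
    {w₀ : EuclideanSpace ℝ (Fin p)} (hw₀ : w₀ ∈ φ.target) {S : Set ℝ} {x : ℝ → M}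
    {l : ℝ → EuclideanSpace ℝ (Fin n) →L[ℝ] ℝ} :
    AdjointEqOn φ f r w₀ x l S ↔
      ∀ e ∈ IsManifold.maximalAtlas (𝓡 n) ∞ M, ∀ t ∈ S, x t ∈ e.source → ∀ i : Fin n,
        HasDerivWithinAt (fun s => covecComp e (x s) (l s) i)
          (-(∑ j, covecComp e (x t) (l t) j *
            partialDeriv e i (fun y => vecComp e y (f (φ.symm w₀) t y) j) (x t))
            - partialDeriv e i (fun y => r y (φ.symm w₀) t) (x t)) S t := by
  refine forall₂_congr fun e he => forall₃_congr fun t ht hxt => ?_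
  rw [AdjointEqAt, hasDerivWithinAt_covector_iff]
  refine forall_congr' fun i => ?_
  have hG := (differentiableAt_state (w := w₀) (t := t) (contDiffOn_localField hφ he hf) hw₀
    (e.map_source hxt)).hasFDerivAt
  have hcomp : ∀ j, partialDeriv e i (fun y => vecComp e y (f (φ.symm w₀) t y) j) (x t)
      = derivState (localField φ e f) (w₀, t, e (x t)) (EuclideanSpace.single i 1) j := fun j =>
    DFunLike.congr_fun
      ((EuclideanSpace.proj (𝕜 := ℝ) (ι := Fin n) j).hasFDerivAt.comp
        (e (x t)) hG).fderiv _
  have hsum : (coRep e (x t) (l t)) (derivState (localField φ e f) (w₀, t, e (x t))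
      (EuclideanSpace.single i 1)) = ∑ j, covecComp e (x t) (l t) j *
        partialDeriv e i (fun y => vecComp e y (f (φ.symm w₀) t y) j) (x t) := by
    conv_lhs => rw [(coRep e (x t) (l t)).eq_sum_single]
    rw [sum_apply]
    refine Finset.sum_congr rfl fun j _ => ?_
    rw [hcomp]
    rfl
  rw [← hsum]
  rfl

theorem stateEqInCharts_of_isIntegralOn {θ : P} {T : ℝ} {x : ℝ → M}
    (hx : IsIntegralOn f θ (Icc 0 T) x) : StateEqInCharts f θ T x := fun _ he t ht hxt j =>
  (EuclideanSpace.proj (𝕜 := ℝ) (ι := Fin n) j).hasFDerivAt.comp_hasDerivWithinAt t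
    (hasDerivWithinAt_chart he hxt (hx t ht))

/-- The parameter gradient of the cost, with the adjoint state in a parameter chart. -/
theorem hasMFDerivAt_cost [T2Space M]
    (hf : ContMDiff ((𝓡 p).prod (𝓘(ℝ, ℝ).prod (𝓡 n))) (𝓡 n).tangent 1
      (fun q : P × ℝ × M => (⟨q.2.2, f q.1 q.2.1 q.2.2⟩ : TangentBundle (𝓡 n) M)))
    {F : M → P → ℝ}
    (hr : ContMDiff ((𝓡 n).prod ((𝓡 p).prod 𝓘(ℝ, ℝ))) 𝓘(ℝ, ℝ) 1
      (fun q : M × P × ℝ => r q.1 q.2.1 q.2.2))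
    {T : ℝ} (hT : 0 ≤ T) {x₀ : M}
    (hflow : ∀ θ : P, ∃ x : ℝ → M, IsSolutionOn f θ x₀ (Icc 0 T) x) {θ : P}
    (hF : MDifferentiableAt ((𝓡 n).prod (𝓡 p)) 𝓘(ℝ, ℝ) (fun q : M × P => F q.1 q.2)
      (flow f θ T x₀, θ))
    {l : ℝ → EuclideanSpace ℝ (Fin n) →L[ℝ] ℝ}
    (hl : AdjointEqOn (chartAt (EuclideanSpace ℝ (Fin p)) θ) f r
      (chartAt (EuclideanSpace ℝ (Fin p)) θ θ) (fun t => flow f θ t x₀) l (Icc 0 T))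
    (hlT : l T = differential (fun y => F y θ) (flow f θ T x₀))
    {dF : EuclideanSpace ℝ (Fin p) →L[ℝ] ℝ}
    (hdF : differential (fun θ' => F (flow f θ T x₀) θ') θ = dF) :
    HasMFDerivAt (𝓡 p) 𝓘(ℝ, ℝ) (cost f F r T x₀) θ
      (dF + ∫ t in (0 : ℝ)..T, hamiltonianDeriv (chartAt (EuclideanSpace ℝ (Fin p)) θ) f r
          (chartAt (EuclideanSpace ℝ (Fin p)) θ θ) (fun t => flow f θ t x₀) l t) := by
  set φ := chartAt (EuclideanSpace ℝ (Fin p)) θ with hφ_def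
  have hφ : φ ∈ IsManifold.maximalAtlas (𝓡 p) ∞ P := chartAt_mem_maximalAtlas θ
  have hθs : θ ∈ φ.source := mem_chart_source _ θ
  set w₀ := φ θ with hw₀_def
  have hw₀ : w₀ ∈ φ.target := φ.map_source hθs
  have hθ : φ.symm w₀ = θ := φ.left_inv hθs
  set Y : EuclideanSpace ℝ (Fin p) → ℝ → M := fun w t => flow f (φ.symm w) t x₀ with hY_def
  have hYx : Y w₀ = fun t => flow f θ t x₀ := by simp only [hY_def, hθ]
  have hYsol : ∀ w, IsSolutionOn f (φ.symm w) x₀ (Icc 0 T) (Y w) := fun w =>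
    isSolutionOn_flow hf hT (hflow _)
  obtain ⟨hO, ho⟩ := gradient_integrated hφ hf hr hw₀ hT (fun w _ => (hYsol w).2)
    (fun w _ => (hYsol w).1) (l := l) (by rw [hYx]; exact hl)
  rw [hYx] at ho
  set xT := flow f θ T x₀ with hxT
  have hYT : Y w₀ T = xT := congrFun hYx T
  set c := chartAt (EuclideanSpace ℝ (Fin n)) xT with hc
  have hcs : xT ∈ c.source := mem_chart_source _ _
  set Fc : EuclideanSpace ℝ (Fin n) × EuclideanSpace ℝ (Fin p) → ℝ :=
    fun z => F (c.symm z.1) (φ.symm z.2) with hFc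
  have hFd : DifferentiableAt ℝ Fc (c xT, w₀) := by
    refine mdifferentiableAt_iff_differentiableAt.1 ?_
    have h1 : MDifferentiableAt 𝓘(ℝ, EuclideanSpace ℝ (Fin n) × EuclideanSpace ℝ (Fin p)) (𝓡 n)
        (fun z => c.symm z.1) (c xT, w₀) :=
      MDifferentiableAt.comp (I' := 𝓡 n) (c xT, w₀)
        ((contMDiffAt_symm_of_mem_maximalAtlas (chartAt_mem_maximalAtlas xT)
          (c.map_source hcs)).mdifferentiableAt (by simp))
        differentiableAt_fst.mdifferentiableAt
    have h2 : MDifferentiableAt 𝓘(ℝ, EuclideanSpace ℝ (Fin n) × EuclideanSpace ℝ (Fin p)) (𝓡 p)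
        (fun z => φ.symm z.2) (c xT, w₀) :=
      MDifferentiableAt.comp (I' := 𝓡 p) (c xT, w₀)
        ((contMDiffAt_symm_of_mem_maximalAtlas hφ hw₀).mdifferentiableAt (by simp))
        differentiableAt_snd.mdifferentiableAt
    refine MDifferentiableAt.comp (I' := (𝓡 n).prod (𝓡 p)) (c xT, w₀) (g := fun q : M × P =>
      F q.1 q.2) ?_ (h1.prodMk h2)
    simp only [c.left_inv hcs, hθ]
    exact hF
  set L := fderiv ℝ Fc (c xT, w₀) with hL
  have hLd : HasFDerivAt Fc L (c xT, w₀) := hFd.hasFDerivAt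
  -- The final condition says that `l T` is the state part of the joint derivative of F; this makes
  -- the boundary pairing match the chain rule.
  have hLx : l T = L.comp (ContinuousLinearMap.inl ℝ _ _) := by
    rw [hlT]
    refine (hasMFDerivAt_of_chart ?_).mfderiv
    have h := HasFDerivAt.comp (c xT) (g := Fc) (f := fun u => (u, w₀)) hLd
      (hasFDerivAt_prodMk_left (c xT) w₀)
    refine h.congr_of_eventuallyEq (.of_forall fun u => ?_)
    simp only [hFc, Function.comp_apply, hθ]
    rfl
  have hLθ : dF = L.comp (ContinuousLinearMap.inr ℝ _ _) := by
    rw [← hdF]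
    refine (hasMFDerivAt_of_chart ?_).mfderiv
    have h := HasFDerivAt.comp w₀ (g := Fc) (f := fun w => (c xT, w)) hLd
      (hasFDerivAt_prodMk_right (c xT) w₀)
    refine h.congr_of_eventuallyEq (.of_forall fun u => ?_)
    simp only [hFc, Function.comp_apply, c.left_inv hcs]
    rfl
  rw [hLθ]
  refine hasMFDerivAt_of_chart ?_
  refine .of_isLittleO ?_
  have h0 : Tendsto (fun w => w - w₀) (𝓝 w₀) (𝓝 0) := by
    have : Tendsto (fun w => w - w₀) (𝓝 w₀) (𝓝 (w₀ - w₀)) := tendsto_id.sub_const w₀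
    rwa [sub_self] at this
  obtain ⟨hsrc, hO⟩ := hO
  rw [hYT] at hsrc
  have hdisp : ∀ w, displacement (n := n) Y w₀ T w = c (Y w T) - c xT := fun w => by
    simp only [displacement, hYT, hc]
  have hOc : (fun w => c (Y w T) - c xT) =O[𝓝 w₀] fun w => w - w₀ :=
    hO.congr_left hdisp
  have hlim : Tendsto (fun w => (c (Y w T), w)) (𝓝 w₀) (𝓝 (c xT, w₀)) := by
    refine Tendsto.prodMk_nhds ?_ tendsto_id
    simpa using (hOc.trans_tendsto h0).add_const (c xT)
  have hFo : (fun w => Fc (c (Y w T), w) - Fc (c xT, w₀) - L ((c (Y w T), w) - (c xT, w₀)))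
      =o[𝓝 w₀] fun w => w - w₀ :=
    (hLd.isLittleO.comp_tendsto hlim).trans_isBigO (hOc.prod_left (isBigO_refl _ _))
  -- `hFo` subtracts `l T` of the displacement and `ho` adds it, so the unknown variation of the end
  -- point drops out.
  refine (hFo.add ho).congr' ?_ .rfl
  filter_upwards [hsrc] with w hw
  have hint : ∀ w, IntervalIntegrable (fun t => r (Y w t) (φ.symm w) t) volume 0 T := fun w =>
    ContinuousOn.intervalIntegrable (by
      rw [uIcc_of_le hT]
      exact continuousOn_runningCost hr (IsIntegralOn.continuousOn (hYsol w).2) _)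
  have hint₀ : IntervalIntegrable (fun t => r (flow f θ t x₀) (φ.symm w₀) t) volume 0 T := by
    have h := hint w₀
    rwa [hYx] at h
  have hsplit : L ((c (Y w T), w) - (c xT, w₀)) = l T (c (Y w T) - c xT)
      + L.comp (ContinuousLinearMap.inr ℝ _ _) (w - w₀) := by
    rw [hLx]
    simp [← map_add]
  have e1 : Fc (c (Y w T), w) = F (Y w T) (φ.symm w) := by
    simp only [hFc, c.left_inv hw]
  have e2 : Fc (c xT, w₀) = F xT θ := by
    simp only [hFc, c.left_inv hcs, hθ]
  rw [intervalIntegral.integral_sub (hint w) hint₀, hdisp, hsplit, e1, e2]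
  change _ = cost f F r T x₀ (φ.symm w) - cost f F r T x₀ (φ.symm w₀) - _
  rw [hθ, add_apply]
  simp only [cost, hY_def]
  ring

end Components

end AdjointMethod

end

end

/-! ### The theorem. -/

open AdjointMethod

theorem mainTheorem2 {n p : ℕ}
    {M : Type*} [TopologicalSpace M] [T2Space M] [ChartedSpace (EuclideanSpace ℝ (Fin n)) M]
    [IsManifold (𝓡 n) ∞ M]
    {P : Type*} [TopologicalSpace P] [ChartedSpace (EuclideanSpace ℝ (Fin p)) P]
    [IsManifold (𝓡 p) ∞ P]
    (f : P → ℝ → (x : M) → TangentSpace (𝓡 n) x)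
    (hf : ContMDiff ((𝓡 p).prod (𝓘(ℝ, ℝ).prod (𝓡 n))) (𝓡 n).tangent 1
      (fun q : P × ℝ × M => (⟨q.2.2, f q.1 q.2.1 q.2.2⟩ : TangentBundle (𝓡 n) M)))
    (F : M → P → ℝ)
    (hF : MDifferentiable ((𝓡 n).prod (𝓡 p)) 𝓘(ℝ, ℝ) (fun q : M × P => F q.1 q.2))
    (r : M → P → ℝ → ℝ)
    (hr : ContMDiff ((𝓡 n).prod ((𝓡 p).prod 𝓘(ℝ, ℝ))) 𝓘(ℝ, ℝ) 1
      (fun q : M × P × ℝ => r q.1 q.2.1 q.2.2))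
    (T : ℝ) (hT : 0 ≤ T) (x₀ : M)
    (hflow : ∀ θ : P, ∃ x : ℝ → M, AdjointMethod.IsSolutionOn f θ x₀ (Set.Icc 0 T) x)
    (θ : P) :
    -- the state `x(t)` solves the dynamics, also in coordinates
    AdjointMethod.IsSolutionOn f θ x₀ (Set.Icc 0 T) (fun t => AdjointMethod.flow f θ t x₀) ∧
    AdjointMethod.StateEqInCharts f θ T (fun t => AdjointMethod.flow f θ t x₀) ∧
    -- the running cost is integrable and the cost is differentiable in the parameter
    (∀ θ' : P, IntervalIntegrable (fun s => r (AdjointMethod.flow f θ' s x₀) θ' s)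
      MeasureTheory.volume 0 T) ∧
    MDifferentiableAt (𝓡 p) 𝓘(ℝ, ℝ) (AdjointMethod.cost f F r T x₀) θ ∧
    -- the adjoint state exists, is unique on `[0, T]`, and gives the parameter gradient
    ∃ l : (t : ℝ) → TangentSpace (𝓡 n) (AdjointMethod.flow f θ t x₀) →L[ℝ] ℝ,
      AdjointMethod.IsAdjointState f F r θ T (fun t => AdjointMethod.flow f θ t x₀) l ∧
      (∀ l' : (t : ℝ) → TangentSpace (𝓡 n) (AdjointMethod.flow f θ t x₀) →L[ℝ] ℝ,
        AdjointMethod.IsAdjointState f F r θ T (fun t => AdjointMethod.flow f θ t x₀) l' →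
          ∀ t ∈ Set.Icc 0 T, l' t = l t) ∧
      (∀ t ∈ Set.Icc 0 T, MDifferentiableAt (𝓡 p) 𝓘(ℝ, ℝ)
        (fun θ' => l t (f θ' t (AdjointMethod.flow f θ t x₀))
          + r (AdjointMethod.flow f θ t x₀) θ' t) θ) ∧
      ∀ v : TangentSpace (𝓡 p) θ,
        IntervalIntegrable (fun t => AdjointMethod.differential
            (fun θ' => l t (f θ' t (AdjointMethod.flow f θ t x₀))
              + r (AdjointMethod.flow f θ t x₀) θ' t) θ v) MeasureTheory.volume 0 T ∧
        AdjointMethod.differential (AdjointMethod.cost f F r T x₀) θ v =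
          AdjointMethod.differential (fun θ' => F (AdjointMethod.flow f θ T x₀) θ') θ v
          + ∫ t in (0 : ℝ)..T, AdjointMethod.differential
            (fun θ' => l t (f θ' t (AdjointMethod.flow f θ t x₀))
              + r (AdjointMethod.flow f θ t x₀) θ' t) θ v := by
  set φ := chartAt (EuclideanSpace ℝ (Fin p)) θ with hφ_def
  have hφ : φ ∈ IsManifold.maximalAtlas (𝓡 p) ∞ P := chartAt_mem_maximalAtlas θ
  have hθs : θ ∈ φ.source := mem_chart_source _ θ
  have hw₀ : φ θ ∈ φ.target := φ.map_source hθs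
  have hθ : φ.symm (φ θ) = θ := φ.left_inv hθs
  have hsol : ∀ θ', IsSolutionOn f θ' x₀ (Set.Icc 0 T) (fun t => flow f θ' t x₀) := fun θ' =>
    isSolutionOn_flow hf hT (hflow θ')
  have hx : IsIntegralOn f θ (Set.Icc 0 T) (fun t => flow f θ t x₀) := (hsol θ).2
  -- The chart lemmas take the parameter as `φ.symm w`; here `w = φ θ` in the preferred chart, where
  -- derivatives in `w` are the manifold derivatives at `θ`.
  have hx' : IsIntegralOn f (φ.symm (φ θ)) (Set.Icc 0 T) (fun t => flow f θ t x₀) := by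
    rwa [hθ]
  obtain ⟨l, hlT, hl⟩ := exists_adjointEqOn hφ hf hr hw₀ hT hx'
    (differential (fun y => F y θ) (flow f θ T x₀))
  have hcost := hasMFDerivAt_cost hf hr hT hflow (hF _) hl hlT rfl
  have hham : ∀ t, HasMFDerivAt (𝓡 p) 𝓘(ℝ, ℝ) (fun θ' => l t (f θ' t (flow f θ t x₀))
      + r (flow f θ t x₀) θ' t) θ
      (hamiltonianDeriv φ f r (φ θ) (fun t => flow f θ t x₀) l t) := fun t =>
    hasMFDerivAt_of_chart (hasFDerivAt_hamiltonian hφ (chartAt_mem_maximalAtlas _) hf hr hw₀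
      (mem_chart_source _ (flow f θ t x₀)) t (l t)).differentiableAt.hasFDerivAt
  have hHc : ContinuousOn (hamiltonianDeriv φ f r (φ θ) (fun t => flow f θ t x₀) l)
      (Set.uIcc 0 T) := by
    rw [Set.uIcc_of_le hT]
    exact continuousOn_hamiltonianDeriv hφ hf hr hw₀ hx.continuousOn hl
  have hHint : IntervalIntegrable (hamiltonianDeriv φ f r (φ θ) (fun t => flow f θ t x₀) l)
      MeasureTheory.volume 0 T := hHc.intervalIntegrable
  have hdiff : ∀ v : EuclideanSpace ℝ (Fin p), (fun t => differential
      (fun θ' => l t (f θ' t (flow f θ t x₀)) + r (flow f θ t x₀) θ' t) θ v)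
      = fun t => hamiltonianDeriv φ f r (φ θ) (fun t => flow f θ t x₀) l t v := fun v =>
    funext fun t => DFunLike.congr_fun (hham t).mfderiv v
  refine ⟨hsol θ, stateEqInCharts_of_isIntegralOn hx, fun θ' => ?_, hcost.mdifferentiableAt,
    l, ⟨?_, hlT⟩, fun l' hl' => ?_, fun t _ => (hham t).mdifferentiableAt, fun v => ?_⟩
  · refine ContinuousOn.intervalIntegrable ?_
    rw [Set.uIcc_of_le hT]
    exact continuousOn_runningCost hr (IsIntegralOn.continuousOn (hsol θ').2) θ'
  · have h := (adjointEqOn_iff hφ hf hw₀).1 hl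
    simp only [hθ] at h
    exact h
  · refine AdjointEqOn.eqOn hφ hf hr hw₀ hT hx.continuousOn hl ?_ (hl'.2.trans hlT.symm)
    refine (adjointEqOn_iff hφ hf hw₀).2 ?_
    simp only [hθ]
    exact hl'.1
  · refine ⟨(congrArg (fun g => IntervalIntegrable g MeasureTheory.volume 0 T) (hdiff v)).mpr
      (hHc.clm_apply continuousOn_const).intervalIntegrable, ?_⟩
    refine (DFunLike.congr_fun hcost.mfderiv v).trans
      ((add_apply (F := EuclideanSpace ℝ (Fin p) →L[ℝ] ℝ) _ _ v).trans (congrArg₂ (· + ·) rfl ?_))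
    exact (ContinuousLinearMap.intervalIntegral_apply hHint v).trans
      (congrArg (fun g : ℝ → ℝ => ∫ t in (0 : ℝ)..T, g t) (hdiff v)).symm
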